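/- Let $(N,g)$ be a Riemannian manifold of dimension $n$ (smooth, Hausdorff, second countable, without boundary), and let $T\subset N$ be a compact embedded submanifold (without boundary) of dimension $k$, $0\le k\le n$. Let $\nu^*T\subset T^*N$ be the conormal bundle of $T$, $\theta=p\,dq$, $\omega=-d\theta=\sum_i dq^i\wedge dp_i$, $H_g(q,p)=\frac12|p|_g^2$, and let $X_{H_g}$ be given by $\omega(X_{H_g},\cdot)=dH_g$. On the space $\Omega$ of smooth paths $\gamma:[0,1]\to T^*N$ with $\gamma(0),\gamma(1)\in\nu^*T$ consider $$\mathcal A(\gamma)=-\int\gamma^*\theta+\int_0^1H_g(\gamma(t))\,dt .$$ The tangent space $T_\gamma\Omega$ consists of the smooth vector fields $\xi$ along $\gamma$ with $\xi(0),\xi(1)$ tangent to $\nu^*T$. Hamiltonian chords are the $\gamma\in\Omega$ with $\dot\gamma=X_{H_g}(\gamma)$. Let $\widehat T$ be the set of constant Hamiltonian chords. (1) $\widehat T$ is exactly the set of constant paths $\gamma_q\equiv(q,0)$ with $q\in T$. (2) The map $q\mapsto\gamma_q$ is a diffeomorphism from $T$ onto $\widehat T\subset\Omega$ (it is bijective,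 and a map $f$ from an open subset of some $\mathbb R^m$ to $T$ is smooth if and only if $(s,t)\mapsto\gamma_{f(s)}(t)$ is smooth). Moreover $\widehat T$ is Morse–Bott nondegenerate in $\Omega$: for each $q\in T$ the Hessian $d^2\mathcal A(\gamma_q)$ on $T_{\gamma_q}\Omega$ (the mixed second derivative of $\mathcal A$ along two-parameter variations of $\gamma_q$ in $\Omega$) is well defined, and $$\ker d^2\mathcal A(\gamma_q)=T_{\gamma_q}\widehat T ,$$ where $T_{\gamma_q}\widehat T$ is the space of variation fields of smooth curves in $\widehat T$ through $\gamma_q$; and $$\operatorname{Coker} d^2\mathcal A(\gamma_q)\cap (T_{\gamma_q}\widehat T)^\circ=\{0\}$$ in the space $L^2$ of square integrable vector fields along $\gamma_q$. Here the inner product of $L^2$ comes from the Sasaki metric $g\oplus g^\flat$ on $T_{(q,0)}(T^*N)=T_qN\oplus T_q^*N$, with $g^\flat$ the metric dual to $g$, and, for a pairing $P$ on $T_{(q,0)}(T^*N)$, $d^2\mathcal A(\gamma_q)$ is represented by an operator $D:T_{\gamma_q}\Omega\to L^2$ with $d^2\mathcal A(\gamma_q)(\xi_1,\xi_2)=\int_0^1P(D\xi_1,\xi_2)\,dt$,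 the cokernel is the $L^2$-orthogonal complement of the image of $D$, and $(T_{\gamma_q}\widehat T)^\circ=\{\eta\in L^2:\int_0^1P(\xi,\eta)\,dt=0\ \text{for all }\xi\in T_{\gamma_q}\widehat T\}$. The operator $D$ exists and the statement holds both for $P=\omega$ and for $P$ equal to the Sasaki metric. -/

import Mathlib

open Set Filter Topology Bundle Manifold MeasureTheory
open scoped ContDiff unitInterval

noncomputable section

namespace ConormalChords

/-! ### Paths and families of paths in a manifold -/

section Paths

variable {F : Type*} [NormedAddCommGroup F] [NormedSpace ℝ F]
  {H : Type*} [TopologicalSpace H] (J : ModelWithCorners ℝ F H)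
  {M : Type*} [TopologicalSpace M] [ChartedSpace H M]

/-- The velocity at parameter `s` of a curve `c : ℝ → M`, as a point of the tangent bundle. -/
def curveVelocity (c : ℝ → M) (s : ℝ) : TangentBundle J M :=
  ⟨c s, mfderiv 𝓘(ℝ, ℝ) J c s (1 : ℝ)⟩

/-- `v` is tangent at `x` to the subset `S`: it is the initial velocity of a smooth curve
lying in `S`.  For an embedded submanifold these vectors form the usual tangent space. -/
def IsTangentTo (S : Set M) (x : M) (v : TangentSpace J x) : Prop :=
  ∃ (c : ℝ → M) (U : Set ℝ), IsOpen U ∧ (0 : ℝ) ∈ U ∧ ContMDiffOn 𝓘(ℝ, ℝ) J ∞ c U ∧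
    (∀ s ∈ U, c s ∈ S) ∧ curveVelocity J c 0 = (⟨x, v⟩ : TangentBundle J M)

/-- A smooth path `[0,1] → M`. -/
def SmoothPath (γ : I → M) : Prop :=
  ContMDiffOn 𝓘(ℝ, ℝ) J ∞ (IccExtend (zero_le_one (α := ℝ)) γ) (Icc 0 1)

/-- A family of paths parametrised by (an open subset `U` of) a normed space `P` is smooth if it is
jointly smooth in the parameter and in time. -/
def SmoothFamilyOn {P : Type*} [NormedAddCommGroup P] [NormedSpace ℝ P]
    (U : Set P) (Γ : P → I → M) : Prop :=
  ContMDiffOn 𝓘(ℝ, P × ℝ) J ∞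
    (fun z : P × ℝ => IccExtend (zero_le_one (α := ℝ)) (Γ z.1) z.2) (U ×ˢ Icc 0 1)

/-- The velocity (one-sided at the end points) of a path `[0,1] → M`. -/
def velocity (γ : I → M) (t : I) : TangentSpace J (γ t) :=
  mfderivWithin 𝓘(ℝ, ℝ) J (IccExtend (zero_le_one (α := ℝ)) γ) (Icc 0 1) (t : ℝ) (1 : ℝ)

/-- The space of smooth paths in `M` with both end points on `L`. -/
def pathSpace (L : Set M) : Set (I → M) :=
  {γ | SmoothPath J γ ∧ γ 0 ∈ L ∧ γ 1 ∈ L}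

variable [IsManifold J ∞ M]

/-- The tangent space at `γ` of the path space: smooth vector fields along `γ` which
are tangent to `L` at both ends. -/
def pathTangent (L : Set M) (γ : I → M) : Set (∀ t, TangentSpace J (γ t)) :=
  {ξ | SmoothPath J.tangent (fun t => (⟨γ t, ξ t⟩ : TangentBundle J M)) ∧
    IsTangentTo J L (γ 0) (ξ 0) ∧ IsTangentTo J L (γ 1) (ξ 1)}


/-- The tangent space at `γ` of a family `𝓕` of paths: the variation fields of smooth curves of
paths which stay in `𝓕` and start at `γ`. -/
def familyTangent (𝓕 : Set (I → M)) (γ : I → M) : Set (∀ t, TangentSpace J (γ t)) :=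
  {ξ | ∃ (Γ : ℝ → I → M) (U : Set ℝ), IsOpen U ∧ (0 : ℝ) ∈ U ∧ SmoothFamilyOn J U Γ ∧
    (∀ s ∈ U, Γ s ∈ 𝓕) ∧
    ∀ t, curveVelocity J (fun s => Γ s t) 0 = (⟨γ t, ξ t⟩ : TangentBundle J M)}

/-- `Γ` is a smooth two-parameter variation of `γ` through paths with end points on `L`,
with variation fields `ξ₁` and `ξ₂` in the two parameter directions. -/
def IsVariation (L : Set M) (γ : I → M) (ξ₁ ξ₂ : ∀ t, TangentSpace J (γ t))
    (Γ : ℝ × ℝ → I → M) : Prop :=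
  (∃ U : Set (ℝ × ℝ), IsOpen U ∧ (0, 0) ∈ U ∧ SmoothFamilyOn J U Γ ∧
    ∀ z ∈ U, Γ z 0 ∈ L ∧ Γ z 1 ∈ L) ∧
  (∀ t, curveVelocity J (fun s => Γ (s, 0) t) 0 = (⟨γ t, ξ₁ t⟩ : TangentBundle J M)) ∧
  (∀ t, curveVelocity J (fun u => Γ (0, u) t) 0 = (⟨γ t, ξ₂ t⟩ : TangentBundle J M))

/-- `B` is the Hessian (second variation) at `γ` of the functional `A` on the space of paths with
end points on `L`: every pair of tangent vectors of the path space is realised by a two-parameter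
variation, and `B ξ₁ ξ₂` is the mixed second derivative of `A` along every such variation.
This determines `B` on the tangent space of the path space. -/
def IsHessian (A : (I → M) → ℝ) (L : Set M) (γ : I → M)
    (B : (∀ t, TangentSpace J (γ t)) → (∀ t, TangentSpace J (γ t)) → ℝ) : Prop :=
  ∀ ξ₁ ∈ pathTangent J L γ, ∀ ξ₂ ∈ pathTangent J L γ,
    (∃ Γ, IsVariation J L γ ξ₁ ξ₂ Γ) ∧
    ∀ Γ, IsVariation J L γ ξ₁ ξ₂ Γ →
      ∃ A' : ℝ → ℝ, (∀ᶠ s in 𝓝 0, HasDerivAt (fun u => A (Γ (s, u))) (A' s) 0) ∧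
        HasDerivAt A' (B ξ₁ ξ₂) 0

/-- The kernel of a Hessian `B` on the tangent space of the path space. -/
def hessianKernel (L : Set M) (γ : I → M)
    (B : (∀ t, TangentSpace J (γ t)) → (∀ t, TangentSpace J (γ t)) → ℝ) :
    Set (∀ t, TangentSpace J (γ t)) :=
  {ξ | ξ ∈ pathTangent J L γ ∧ ∀ ξ₂ ∈ pathTangent J L γ, B ξ ξ₂ = 0}

end Paths

/-! ### The cotangent bundle of a Riemannian manifold -/

/-- The model vector space `ℝⁿ`. -/
abbrev Model (n : ℕ) : Type := EuclideanSpace ℝ (Fin n)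

/-- The model vector space `ℝⁿ × (ℝⁿ)*` of the cotangent bundle. -/
abbrev CotModel (n : ℕ) : Type := Model n × (Model n →L[ℝ] ℝ)

section Cotangent

variable {n : ℕ} {N : Type*} [TopologicalSpace N] [ChartedSpace (Model n) N]
  [IsManifold (𝓡 n) ∞ N]

variable (n) in
/-- `T` is an embedded `k`-dimensional submanifold (without boundary) of `N`: near each of its
points there is a slice chart. -/
def IsSubmanifold (k : ℕ) (T : Set N) : Prop :=
  ∀ q ∈ T, ∃ φ ∈ IsManifold.maximalAtlas (𝓡 n) ∞ N, q ∈ φ.source ∧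
    ∀ y ∈ φ.source, y ∈ T ↔ ∀ i : Fin n, k ≤ (i : ℕ) → φ y i = 0

variable (n N) in
/-- The cotangent bundle `T*N`. -/
abbrev Cotangent : Type _ :=
  TotalSpace (Model n →L[ℝ] ℝ) (fun q : N => TangentSpace (𝓡 n) q →L[ℝ] Bundle.Trivial N ℝ q)

variable (n) in
/-- The model with corners of the manifold `T*N`. -/
abbrev cotI : ModelWithCorners ℝ (CotModel n) (ModelProd (Model n) (Model n →L[ℝ] ℝ)) :=
  (𝓡 n).prod 𝓘(ℝ, Model n →L[ℝ] ℝ)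

/-- The zero covector at `q`. -/
def zeroCov (q : N) : Cotangent n N := ⟨q, 0⟩

/-- The conormal bundle of `T`: covectors at points of `T` annihilating the tangent vectors
of `T`. -/
def conormal (T : Set N) : Set (Cotangent n N) :=
  {x | x.1 ∈ T ∧ ∀ v : TangentSpace (𝓡 n) x.1, IsTangentTo (𝓡 n) T x.1 v → x.2 v = 0}

/-- The Liouville form `θ = p dq`. -/
def liouville (x : Cotangent n N) (ζ : TangentSpace (cotI n) x) : ℝ :=
  x.2 (mfderiv (cotI n) (𝓡 n) (fun y : Cotangent n N => y.1) x ζ)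

/-- The canonical symplectic form `ω = -dθ = ∑ dqⁱ ∧ dpᵢ`.  The tangent space of `T*N` at `x` is
the model space `ℝⁿ × (ℝⁿ)*` read in the preferred chart of `T*N` at `x`, which is the
canonical chart `(q, p)` induced by the preferred chart of `N` at the base point. -/
def symp (x : Cotangent n N) (ζ₁ ζ₂ : TangentSpace (cotI n) x) : ℝ :=
  let a : CotModel n := ζ₁
  let b : CotModel n := ζ₂
  b.2 a.1 - a.2 b.1

/-- A smooth Riemannian metric on `N`. -/
abbrev RiemMetric (n : ℕ) (N : Type*) [TopologicalSpace N] [ChartedSpace (Model n) N]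
    [IsManifold (𝓡 n) ∞ N] : Type _ :=
  ContMDiffRiemannianMetric (𝓡 n) ∞ (Model n) (fun q : N => TangentSpace (𝓡 n) q)

variable (g : RiemMetric n N)

theorem exists_sharp (q : N) (α : TangentSpace (𝓡 n) q →L[ℝ] ℝ) :
    ∃ v : TangentSpace (𝓡 n) q, g.inner q v = α := by
  let f : Model n →ₗ[ℝ] (Model n →L[ℝ] ℝ) := (g.inner q).toLinearMap
  have hinj : Function.Injective f := by
    rw [injective_iff_map_eq_zero]
    intro v hv
    by_contra h
    have h1 := g.pos q v h
    have h2 : g.inner q v = 0 := hv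
    rw [h2] at h1
    exact lt_irrefl _ h1
  have hdim : Module.finrank ℝ (Model n) = Module.finrank ℝ (Model n →L[ℝ] ℝ) :=
    ((LinearMap.toContinuousLinearMap (𝕜 := ℝ) (E := Model n)
      (F' := ℝ)).finrank_eq.symm.trans Subspace.dual_finrank_eq).symm
  exact (LinearMap.injective_iff_surjective_of_finrank_eq_finrank hdim).1 hinj α

/-- The vector `α♯` with `g(α♯, ·) = α`. -/
def sharp (q : N) (α : TangentSpace (𝓡 n) q →L[ℝ] ℝ) : TangentSpace (𝓡 n) q :=
  Classical.choose (exists_sharp g q α)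

theorem inner_sharp (q : N) (α : TangentSpace (𝓡 n) q →L[ℝ] ℝ) :
    g.inner q (sharp g q α) = α :=
  Classical.choose_spec (exists_sharp g q α)

/-- The kinetic energy Hamiltonian `H_g(q, p) = ½ |p|²`. -/
def kinetic (x : Cotangent n N) : ℝ :=
  (1 / 2) * g.inner x.1 (sharp g x.1 x.2) (sharp g x.1 x.2)

/-- The action functional `A(γ) = -∫ γ*θ + ∫₀¹ H_g(γ(t)) dt`. -/
def action (γ : I → Cotangent n N) : ℝ :=
  -(∫ t : I, liouville (γ t) (velocity (cotI n) γ t)) + ∫ t : I, kinetic g (γ t)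

/-- The Hamiltonian chords of `H_g` attached to `L`: paths with end points on `L` satisfying
`γ' = X_H(γ)`, where the Hamiltonian vector field is given by `ω(X_H, ·) = dH`. -/
def chords (L : Set (Cotangent n N)) : Set (I → Cotangent n N) :=
  {γ | γ ∈ pathSpace (cotI n) L ∧ ∀ t, ∀ ζ : TangentSpace (cotI n) (γ t),
    symp (γ t) (velocity (cotI n) γ t) ζ =
      mfderiv (cotI n) 𝓘(ℝ, ℝ) (kinetic g) (γ t) ζ}

/-- The constant Hamiltonian chords. -/
def constChords (L : Set (Cotangent n N)) : Set (I → Cotangent n N) :=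
  {γ | γ ∈ chords g L ∧ ∃ x, ∀ t, γ t = x}

variable (n) in
/-- The constant path at the zero covector over `q`. -/
def constPath (q : N) : I → Cotangent n N := fun _ => zeroCov q

/-- `e` restricts to a diffeomorphism from the submanifold `T` onto the family `𝓕` of paths: it is
a bijection, and a map `f` from an open subset of some `ℝᵐ` to `T` is smooth iff the family
of paths `e ∘ f` is smooth. -/
def IsDiffeoOnto (T : Set N) (𝓕 : Set (I → Cotangent n N)) (e : N → I → Cotangent n N) : Prop :=
  BijOn e T 𝓕 ∧ ∀ (m : ℕ) (U : Set (Model m)) (f : Model m → N), IsOpen U → MapsTo f U T →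
    (ContMDiffOn (𝓡 m) (𝓡 n) ∞ f U ↔ SmoothFamilyOn (cotI n) U (fun s => e (f s)))

/-! ### Square integrable vector fields along a constant path at a zero covector -/

/-- The Sasaki metric at the zero covector over `q`: the orthogonal sum of `g` on the horizontal
space `T_qN` and of the dual metric on the vertical space `T_q^*N`.  The decomposition
`T_(q,0)(T*N) = T_qN × T_q^*N` is the one given by the zero section and the fibre. -/
def sasaki (q : N) (ζ₁ ζ₂ : TangentSpace (cotI n) (zeroCov (n := n) q)) : ℝ :=
  let a : CotModel n := ζ₁
  let b : CotModel n := ζ₂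
  g.inner q a.1 b.1 + g.inner q (sharp g q a.2) (sharp g q b.2)

/-- Square integrable vector fields along `constPath n q`, modulo equality almost everywhere;
the fibre `T_(q,0)(T*N)` does not depend on time. -/
abbrev L2Fields (n : ℕ) : Type := Lp (CotModel n) 2 (volume : Measure I)

/-- Vector fields along `constPath n q`. -/
abbrev Fields (n : ℕ) {N : Type*} [TopologicalSpace N] [ChartedSpace (Model n) N]
    [IsManifold (𝓡 n) ∞ N] (q : N) : Type :=
  ∀ t : I, TangentSpace (cotI n) (constPath n q t)

/-- The operator `D`, from the tangent space of the path space to `L²`, represents the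
Hessian `B` at `constPath n q` through the pairing `P`: `B(ξ₁, ξ₂) = ∫₀¹ P(D ξ₁(t), ξ₂(t)) dt`. -/
def Represents (L : Set (Cotangent n N)) (q : N)
    (P : TangentSpace (cotI n) (zeroCov (n := n) q) →
      TangentSpace (cotI n) (zeroCov (n := n) q) → ℝ)
    (B : Fields n q → Fields n q → ℝ) (D : Fields n q → L2Fields n) : Prop :=
  ∀ ξ₁ ∈ pathTangent (cotI n) L (constPath n q), ∀ ξ₂ ∈ pathTangent (cotI n) L (constPath n q),
    B ξ₁ ξ₂ = ∫ t : I, P (D ξ₁ t) (ξ₂ t)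

/-- The `L²`-cokernel of an operator `D` on the tangent space of the path space: the orthogonal
complement of its image in `L²`. -/
def cokernel (L : Set (Cotangent n N)) (q : N) (D : Fields n q → L2Fields n) :
    Set (L2Fields n) :=
  {η | ∀ ξ ∈ pathTangent (cotI n) L (constPath n q), ∫ t : I, sasaki g q (D ξ t) (η t) = 0}

/-- The annihilator in `L²` of a set `V` of vector fields, with respect to the pairing `∫ P`. -/
def annihilator (q : N)
    (P : TangentSpace (cotI n) (zeroCov (n := n) q) →
      TangentSpace (cotI n) (zeroCov (n := n) q) → ℝ)
    (V : Set (Fields n q)) : Set (L2Fields n) :=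
  {η | ∀ ξ ∈ V, ∫ t : I, P (ξ t) (η t) = 0}

/-- Nondegeneracy of the action functional along the family `𝓕` of critical paths at the member
`constPath n q`: the Hessian exists, its kernel is the tangent space of `𝓕`, and the cokernel of
the operator representing the Hessian meets the annihilator of the tangent space of `𝓕`
trivially.  The last condition is required both when the Hessian is represented, and the
annihilator is taken, through the symplectic form (the operator is then, up to sign, the
linearisation of `γ' - X_H(γ)`), and through the Sasaki metric. -/
def IsBottNondegenerateAt (L : Set (Cotangent n N)) (𝓕 : Set (I → Cotangent n N)) (q : N) :
    Prop :=
  ∃ B : Fields n q → Fields n q → ℝ,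
    IsHessian (cotI n) (action g) L (constPath n q) B ∧
    hessianKernel (cotI n) L (constPath n q) B = familyTangent (cotI n) 𝓕 (constPath n q) ∧
    (∃ D : Fields n q → L2Fields n, Represents L q (symp (zeroCov q)) B D ∧
      cokernel g L q D ∩
        annihilator q (symp (zeroCov q)) (familyTangent (cotI n) 𝓕 (constPath n q)) = {0}) ∧
    (∃ D : Fields n q → L2Fields n, Represents L q (sasaki g q) B D ∧
      cokernel g L q D ∩
        annihilator q (sasaki g q) (familyTangent (cotI n) 𝓕 (constPath n q)) = {0})

end Cotangent

end ConormalChords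

end

open ConormalChords

noncomputable section

namespace ConormalChords

/-! ### Differentiation under the integral sign over `[0,1]` -/

section ParametricIntegral

variable {E W : Type*} [NormedAddCommGroup E] [NormedSpace ℝ E]
  [NormedAddCommGroup W] [NormedSpace ℝ W]

/-! A constant chord has zero velocity, so the chord equation says that `dH` vanishes at its value.
`H` is quadratic on the fibres, so Euler's identity gives `2H = 0` there and the covector is zero
(`eq_zeroCov_of_mfderiv_kinetic`). The end point condition puts the base point in `T`. Conversely
`H` is minimal on the zero section. The zero section and the bundle projection then give the
diffeomorphism.

For the Hessian at `γ_q`, work in canonical coordinates `(q, p)`. The action is `-∫ p(q') + ∫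
(p/2)(S(q) p)`, with `S(q)` the dual metric. Each integrand pairs two factors that vanish along
`γ_q`, so only their first derivatives survive, and no derivative of the metric enters
(`mixed_deriv_action`). For fields `(a, b)` this leaves `∫ -(b₁(a₂') + b₂(a₁')) + b₁(S b₂)`.

For the boundary condition, choose slice coordinates tangent to the identity at `q`. Their cotangent
lift carries `V × V⁰` to the conormal bundle with identity derivative at the zero covector, so `V ×
V⁰` is the tangent space there (`SliceChart.isTangentTo_conormal_iff`). Since `V⁰` annihilates `V`,
integration by parts has no boundary term and the Hessian is represented through the Sasaki metric
by `(a, b) ↦ (S b', b - G a')` (`IsAdm.linHess_eq`).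

In the kernel, `b` is constant and `a` is affine with slope `S b`. The end points force `S b ∈ V`
while `b ∈ V⁰`, so `|b|² = b(S b) = 0`, leaving the constants `(v, 0)` with `v ∈ V`
(`IsAdm.eq_const`). An element of the cokernel is tested against explicit admissible fields whose
images are arbitrary test functions up to constants in `V`. The annihilator condition removes those
constants (`ae_eq_zero_of_cokernel`). The symplectic version reduces to the Sasaki version through
the compatible almost complex structure (`SliceChart.exists_operator`). -/

theorem uniqueDiffOn_prod_Icc {U : Set E} (hU : IsOpen U) :
    UniqueDiffOn ℝ (U ×ˢ Icc (0 : ℝ) 1) :=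
  hU.uniqueDiffOn.prod (uniqueDiffOn_Icc zero_lt_one)

/-- The partial derivative in a direction of the parameter space is smooth up to the boundary. -/
theorem contDiffOn_partial {U : Set E} (hU : IsOpen U) {F : E × ℝ → W}
    (hF : ContDiffOn ℝ ∞ F (U ×ˢ Icc (0 : ℝ) 1)) (e : E × ℝ) :
    ContDiffOn ℝ ∞ (fun p => fderivWithin ℝ F (U ×ˢ Icc (0 : ℝ) 1) p e) (U ×ˢ Icc (0 : ℝ) 1) :=
  (hF.fderivWithin (uniqueDiffOn_prod_Icc hU) (by simp)).clm_apply contDiffOn_const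

/-- A curve in the parameter space lifts to the derivative of the restricted function. -/
theorem hasDerivAt_partial {U : Set E} (hU : IsOpen U) {F : E × ℝ → W} {t : ℝ}
    (ht : t ∈ Icc (0 : ℝ) 1) (e z : E) {s : ℝ} (hz : z + s • e ∈ U)
    (hF : DifferentiableWithinAt ℝ F (U ×ˢ Icc (0 : ℝ) 1) (z + s • e, t)) :
    HasDerivAt (fun s : ℝ => F (z + s • e, t))
      (fderivWithin ℝ F (U ×ˢ Icc (0 : ℝ) 1) (z + s • e, t) (e, 0)) s := by
  have hl : HasDerivAt (fun s : ℝ => (z + s • e, t)) (e, (0 : ℝ)) s := by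
    have h1 : HasDerivAt (fun s : ℝ => z + s • e) e s := by
      simpa using ((hasDerivAt_id s).smul_const e).const_add z
    exact h1.prodMk (hasDerivAt_const s t)
  have hpre : (fun s : ℝ => (z + s • e, t)) ⁻¹' (U ×ˢ Icc (0 : ℝ) 1) ∈ 𝓝 s := by
    have hc : Continuous fun s : ℝ => z + s • e := by fun_prop
    filter_upwards [hc.continuousAt.preimage_mem_nhds (hU.mem_nhds hz)] with r hr
    exact ⟨hr, ht⟩
  have := hF.hasFDerivWithinAt.comp_hasDerivWithinAt s
    (hl.hasDerivWithinAt (s := (fun s : ℝ => (z + s • e, t)) ⁻¹' (U ×ˢ Icc (0 : ℝ) 1)))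
    (fun r hr => hr)
  exact this.hasDerivAt hpre

/-- The parameter segment around `z` times `[0,1]` is compact, so the continuous partial derivative
is bounded there by a constant, which serves as the dominating function. -/
theorem hasDerivAt_integral_Icc {U : Set E} (hU : IsOpen U) {F : E × ℝ → ℝ}
    (hF : ContDiffOn ℝ ∞ F (U ×ˢ Icc (0 : ℝ) 1)) {z : E} (hz : z ∈ U) (e : E) :
    HasDerivAt (fun s : ℝ => ∫ t in Icc (0 : ℝ) 1, F (z + s • e, t))
      (∫ t in Icc (0 : ℝ) 1, fderivWithin ℝ F (U ×ˢ Icc (0 : ℝ) 1) (z, t) (e, 0)) 0 := by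
  have hc : Continuous fun s : ℝ => z + s • e := by fun_prop
  have hV : (fun s : ℝ => z + s • e) ⁻¹' U ∈ 𝓝 (0 : ℝ) :=
    hc.continuousAt.preimage_mem_nhds (hU.mem_nhds (by simpa using hz))
  obtain ⟨δ, hδ, hδU⟩ := Metric.nhds_basis_closedBall.mem_iff.1 hV
  have hF' := (contDiffOn_partial hU hF (e, 0)).continuousOn
  have hK : IsCompact (((fun s : ℝ => z + s • e) '' Metric.closedBall 0 δ) ×ˢ Icc (0 : ℝ) 1) :=
    ((isCompact_closedBall _ _).image hc).prod isCompact_Icc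
  have hKS : ((fun s : ℝ => z + s • e) '' Metric.closedBall 0 δ) ×ˢ Icc (0 : ℝ) 1
      ⊆ U ×ˢ Icc (0 : ℝ) 1 := by
    rintro ⟨_, t⟩ ⟨⟨s, hs, rfl⟩, ht⟩
    exact ⟨hδU hs, ht⟩
  obtain ⟨C, hC⟩ := hK.exists_bound_of_continuousOn (hF'.mono hKS)
  have hsl : ∀ {G : E × ℝ → ℝ}, ContinuousOn G (U ×ˢ Icc (0 : ℝ) 1) → ∀ {y : E}, y ∈ U →
      ContinuousOn (fun t => G (y, t)) (Icc (0 : ℝ) 1) := fun hG y hy =>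
    hG.comp (by fun_prop) fun t ht => ⟨hy, ht⟩
  have key := hasDerivAt_integral_of_dominated_loc_of_deriv_le
    (μ := volume.restrict (Icc (0 : ℝ) 1)) (x₀ := (0 : ℝ)) (s := Metric.closedBall 0 δ)
    (F := fun s t => F (z + s • e, t)) (bound := fun _ => C)
    (F' := fun s t => fderivWithin ℝ F (U ×ˢ Icc (0 : ℝ) 1) (z + s • e, t) (e, 0))
    (Metric.closedBall_mem_nhds _ hδ) ?_ ?_ ?_ ?_ ?_ ?_
  · simpa using key.2
  · filter_upwards [hV] with s hs
    exact (hsl hF.continuousOn hs).aestronglyMeasurable measurableSet_Icc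
  · exact ((hsl hF.continuousOn (by simpa using hz)).integrableOn_Icc)
  · exact (hsl hF' (by simpa using hz)).aestronglyMeasurable measurableSet_Icc
  · filter_upwards [ae_restrict_mem measurableSet_Icc] with t ht s hs
    exact hC _ ⟨⟨s, hs, rfl⟩, ht⟩
  · exact integrable_const _
  · filter_upwards [ae_restrict_mem measurableSet_Icc] with t ht s hs
    exact hasDerivAt_partial hU ht e z (hδU hs)
      ((hF.differentiableOn (by simp)) _ ⟨hδU hs, ht⟩)

/-- The mixed second derivative at `0` of an integral of a pairing of two functions which
both vanish at the parameter `0`. -/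
theorem mixed_deriv_integral_pairing {U : Set (ℝ × ℝ)} (hU : IsOpen U) (h0 : (0 : ℝ × ℝ) ∈ U)
    {f : (ℝ × ℝ) × ℝ → W →L[ℝ] ℝ} {g : (ℝ × ℝ) × ℝ → W}
    (hf : ContDiffOn ℝ ∞ f (U ×ˢ Icc (0 : ℝ) 1)) (hg : ContDiffOn ℝ ∞ g (U ×ˢ Icc (0 : ℝ) 1))
    (hf0 : ∀ t ∈ Icc (0 : ℝ) 1, f (0, t) = 0) (hg0 : ∀ t ∈ Icc (0 : ℝ) 1, g (0, t) = 0) :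
    ∃ A' : ℝ → ℝ,
      (∀ᶠ s in 𝓝 (0 : ℝ), HasDerivAt
        (fun u : ℝ => ∫ t in Icc (0 : ℝ) 1, f ((s, u), t) (g ((s, u), t))) (A' s) 0) ∧
      HasDerivAt A' (∫ t in Icc (0 : ℝ) 1,
        (fderivWithin ℝ f (U ×ˢ Icc (0 : ℝ) 1) (0, t) ((1, 0), 0)
            (fderivWithin ℝ g (U ×ˢ Icc (0 : ℝ) 1) (0, t) ((0, 1), 0)) +
          fderivWithin ℝ f (U ×ˢ Icc (0 : ℝ) 1) (0, t) ((0, 1), 0)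
            (fderivWithin ℝ g (U ×ˢ Icc (0 : ℝ) 1) (0, t) ((1, 0), 0)))) 0 := by
  set S := U ×ˢ Icc (0 : ℝ) 1 with hS
  have hu := uniqueDiffOn_prod_Icc hU
  have hF : ContDiffOn ℝ ∞ (fun p => f p (g p)) S := hf.clm_apply hg
  have hF2 := contDiffOn_partial hU hF ((0, 1), 0)
  have hfd := hf.differentiableOn (by simp)
  have hgd := hg.differentiableOn (by simp)
  refine ⟨fun s => ∫ t in Icc (0 : ℝ) 1,
    fderivWithin ℝ (fun p => f p (g p)) S ((s, 0), t) ((0, 1), 0), ?_, ?_⟩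
  · have hc : Continuous fun s : ℝ => (s, (0 : ℝ)) := by fun_prop
    filter_upwards [hc.continuousAt.preimage_mem_nhds (hU.mem_nhds h0)] with s hs
    simpa using hasDerivAt_integral_Icc hU hF hs (0, 1)
  · have := hasDerivAt_integral_Icc hU hF2 h0 (1, 0)
    simp only [Prod.smul_mk, smul_eq_mul, mul_one, mul_zero, zero_add] at this
    convert this using 1
    refine setIntegral_congr_fun measurableSet_Icc fun t ht => ?_
    have hp : ((0 : ℝ × ℝ), t) ∈ S := ⟨h0, ht⟩
    have hprod : ∀ p ∈ S, fderivWithin ℝ (fun p => f p (g p)) S p ((0, 1), 0) =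
        f p (fderivWithin ℝ g S p ((0, 1), 0)) + fderivWithin ℝ f S p ((0, 1), 0) (g p) := by
      intro p hp
      rw [((hfd p hp).hasFDerivWithinAt.clm_apply (hgd p hp).hasFDerivWithinAt).fderivWithin
        (hu p hp)]
      simp
    have hf2 := (contDiffOn_partial hU hf ((0, 1), 0)).differentiableOn (by simp) _ hp
    have hg2 := (contDiffOn_partial hU hg ((0, 1), 0)).differentiableOn (by simp) _ hp
    have hd := ((hfd _ hp).hasFDerivWithinAt.clm_apply hg2.hasFDerivWithinAt).add
      (hf2.hasFDerivWithinAt.clm_apply (hgd _ hp).hasFDerivWithinAt)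
    have hd' := (hd.congr hprod (hprod _ hp)).fderivWithin (hu _ hp)
    simp only [← hS]
    rw [hd']
    -- Of the four terms of the product rule, the two containing an undifferentiated factor vanish
    -- at the parameter `0`.
    simp [hf0 t ht, hg0 t ht, add_comm, hS]

theorem two_le_infty : (2 : ℕ∞ω) ≤ ∞ := WithTop.coe_le_coe.2 le_top

/-- The domain is not open in the time direction, but it lies in the closure of its interior, which
suffices for symmetry of second derivatives. It serves to exchange the time derivative with the
variation. -/
theorem partial_comm {U : Set E} (hU : IsOpen U) {F : E × ℝ → W}
    (hF : ContDiffOn ℝ ∞ F (U ×ˢ Icc (0 : ℝ) 1)) {p : E × ℝ} (hp : p ∈ U ×ˢ Icc (0 : ℝ) 1)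
    (v w : E × ℝ) :
    fderivWithin ℝ (fun p => fderivWithin ℝ F (U ×ˢ Icc (0 : ℝ) 1) p v) (U ×ˢ Icc (0 : ℝ) 1) p w =
    fderivWithin ℝ (fun p => fderivWithin ℝ F (U ×ˢ Icc (0 : ℝ) 1) p w)
      (U ×ˢ Icc (0 : ℝ) 1) p v := by
  set S := U ×ˢ Icc (0 : ℝ) 1 with hS
  have hu := uniqueDiffOn_prod_Icc hU
  have hsymm : IsSymmSndFDerivWithinAt ℝ F S p := by
    refine (hF p hp).isSymmSndFDerivWithinAt (by simpa using two_le_infty) hu ?_ hp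
    rw [hS, interior_prod_eq, closure_prod_eq, interior_Icc, closure_Ioo zero_ne_one,
      hU.interior_eq]
    exact ⟨subset_closure hp.1, hp.2⟩
  have hd : DifferentiableWithinAt ℝ (fderivWithin ℝ F S) S p :=
    (hF.fderivWithin (m := 1) hu (by simpa [one_add_one_eq_two] using two_le_infty)).differentiableOn (by simp) p hp
  have h : ∀ v w : E × ℝ, fderivWithin ℝ (fun p => fderivWithin ℝ F S p v) S p w =
      fderivWithin ℝ (fderivWithin ℝ F S) S p w v := by
    intro v w
    rw [(hd.hasFDerivWithinAt.clm_apply (hasFDerivWithinAt_const v p S)).fderivWithin (hu p hp)]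
    simp
  rw [h, h]
  exact hsymm _ _

end ParametricIntegral

/-! ### The linearised problem on a cotangent space -/

section Linear

variable {E : Type*} [NormedAddCommGroup E] [NormedSpace ℝ E]

/-- The derivative along `[0,1]`, one-sided at the end points. -/
abbrev dt {W : Type*} [NormedAddCommGroup W] [NormedSpace ℝ W] (f : ℝ → W) (t : ℝ) : W :=
  derivWithin f (Icc (0 : ℝ) 1) t

theorem contDiffOn_dt {W : Type*} [NormedAddCommGroup W] [NormedSpace ℝ W] {f : ℝ → W}
    (hf : ContDiffOn ℝ ∞ f (Icc (0 : ℝ) 1)) : ContDiffOn ℝ ∞ (dt f) (Icc (0 : ℝ) 1) :=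
  hf.derivWithin (uniqueDiffOn_Icc zero_lt_one) (by simp)

theorem hasDerivWithinAt_dt {W : Type*} [NormedAddCommGroup W] [NormedSpace ℝ W] {f : ℝ → W}
    (hf : ContDiffOn ℝ ∞ f (Icc (0 : ℝ) 1)) {t : ℝ} (ht : t ∈ Icc (0 : ℝ) 1) :
    HasDerivWithinAt f (dt f t) (Icc (0 : ℝ) 1) t :=
  (hf.differentiableOn (by simp) t ht).hasDerivWithinAt

theorem dt_eq {W : Type*} [NormedAddCommGroup W] [NormedSpace ℝ W] {f : ℝ → W} {f' : W} {t : ℝ}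
    (ht : t ∈ Icc (0 : ℝ) 1) (h : HasDerivWithinAt f f' (Icc (0 : ℝ) 1) t) : dt f t = f' :=
  h.derivWithin (uniqueDiffOn_Icc zero_lt_one t ht)

theorem integral_dt {f : ℝ → ℝ} (hf : ContDiffOn ℝ ∞ f (Icc (0 : ℝ) 1)) :
    ∫ t in Icc (0 : ℝ) 1, dt f t = f 1 - f 0 := by
  rw [integral_Icc_eq_integral_Ioc, ← intervalIntegral.integral_of_le zero_le_one]
  refine intervalIntegral.integral_eq_sub_of_hasDerivAt_of_le zero_le_one hf.continuousOn
    (fun t ht => (hasDerivWithinAt_dt hf (Ioo_subset_Icc_self ht)).hasDerivAt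
      (Icc_mem_nhds ht.1 ht.2)) ?_
  rw [intervalIntegrable_iff_integrableOn_Icc_of_le zero_le_one]
  exact (contDiffOn_dt hf).continuousOn.integrableOn_Icc

theorem eq_of_dt_eq_zero {W : Type*} [NormedAddCommGroup W] [NormedSpace ℝ W] {f : ℝ → W}
    (hf : ContDiffOn ℝ ∞ f (Icc (0 : ℝ) 1)) (h : ∀ t ∈ Icc (0 : ℝ) 1, dt f t = 0) :
    ∀ t ∈ Icc (0 : ℝ) 1, f t = f 0 :=
  constant_of_derivWithin_zero (hf.differentiableOn (by simp))
    fun t ht => h t (Ico_subset_Icc_self ht)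

theorem exists_primitive {ψ : ℝ → ℝ} (hψ : ContDiff ℝ ∞ ψ) :
    ∃ Ψ : ℝ → ℝ, ContDiff ℝ ∞ Ψ ∧ (∀ t, HasDerivAt Ψ (ψ t) t) ∧ Ψ 0 = 0 := by
  have hd : ∀ t, HasDerivAt (fun t => ∫ s in (0 : ℝ)..t, ψ s) (ψ t) t := fun t =>
    intervalIntegral.integral_hasDerivAt_right (hψ.continuous.intervalIntegrable _ _)
      (hψ.continuous.stronglyMeasurableAtFilter _ _) hψ.continuous.continuousAt
  refine ⟨fun t => ∫ s in (0 : ℝ)..t, ψ s, ?_, hd, by simp⟩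
  rw [contDiff_infty_iff_deriv]
  refine ⟨fun t => (hd t).differentiableAt, ?_⟩
  rwa [show deriv (fun t => ∫ s in (0 : ℝ)..t, ψ s) = ψ from funext fun t => (hd t).deriv]

/-- The linear conormal space `V × V⁰` of a subspace `V`. -/
def linConormal (V : Submodule ℝ E) : Submodule ℝ (E × (E →L[ℝ] ℝ)) where
  carrier := {z | z.1 ∈ V ∧ ∀ v ∈ V, z.2 v = 0}
  add_mem' := fun ⟨h1, h2⟩ ⟨h3, h4⟩ =>
    ⟨V.add_mem h1 h3, fun v hv => by simp [h2 v hv, h4 v hv]⟩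
  zero_mem' := ⟨V.zero_mem, fun v _ => rfl⟩
  smul_mem' := fun c _ ⟨h1, h2⟩ => ⟨V.smul_mem c h1, fun v hv => by simp [h2 v hv]⟩

/-- Smooth fields on `[0,1]` with end points in the linear conormal space of `V`. -/
def IsAdm (V : Submodule ℝ E) (ζ : ℝ → E × (E →L[ℝ] ℝ)) : Prop :=
  ContDiffOn ℝ ∞ ζ (Icc (0 : ℝ) 1) ∧ ζ 0 ∈ linConormal V ∧ ζ 1 ∈ linConormal V

/-- A scalar product on `E` together with its inverse. -/
structure IsMetricPair (G : E →L[ℝ] E →L[ℝ] ℝ) (S : (E →L[ℝ] ℝ) →L[ℝ] E) : Prop where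
  symm : ∀ v w, G v w = G w v
  pos : ∀ v, v ≠ 0 → 0 < G v v
  right : ∀ α, G (S α) = α

/-- The operator representing the second variation through the Sasaki metric. -/
def hessOp (G : E →L[ℝ] E →L[ℝ] ℝ) (S : (E →L[ℝ] ℝ) →L[ℝ] E) (ζ : ℝ → E × (E →L[ℝ] ℝ))
    (t : ℝ) : E × (E →L[ℝ] ℝ) :=
  (S (dt ζ t).2, (ζ t).2 - G (dt ζ t).1)

/-- The Sasaki metric on the linear model. -/
def linSasaki (G : E →L[ℝ] E →L[ℝ] ℝ) (S : (E →L[ℝ] ℝ) →L[ℝ] E) (x y : E × (E →L[ℝ] ℝ)) : ℝ :=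
  G x.1 y.1 + G (S x.2) (S y.2)

/-- The second variation of the action on the linear model. -/
def linHess (S : (E →L[ℝ] ℝ) →L[ℝ] E) (ζ₁ ζ₂ : ℝ → E × (E →L[ℝ] ℝ)) : ℝ :=
  ∫ t in Icc (0 : ℝ) 1,
    (-((ζ₁ t).2 (dt ζ₂ t).1 + (ζ₂ t).2 (dt ζ₁ t).1) + (ζ₁ t).2 (S (ζ₂ t).2))

variable {G : E →L[ℝ] E →L[ℝ] ℝ} {S : (E →L[ℝ] ℝ) →L[ℝ] E} {V : Submodule ℝ E}

namespace IsMetricPair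

theorem left (h : IsMetricPair G S) (v : E) : S (G v) = v := by
  by_contra hne
  have h1 := h.pos _ (sub_ne_zero.2 hne)
  rw [show G (S (G v) - v) = 0 by rw [map_sub, h.right, sub_self]] at h1
  exact lt_irrefl _ h1

theorem apply_comm (h : IsMetricPair G S) (α β : E →L[ℝ] ℝ) : α (S β) = β (S α) := by
  conv_lhs => rw [← h.right α]
  rw [h.symm, h.right]

theorem eq_zero (h : IsMetricPair G S) {v : E} (hv : G v v = 0) : v = 0 := by
  by_contra hne
  exact (h.pos v hne).ne' hv

theorem nonneg (h : IsMetricPair G S) (v : E) : 0 ≤ G v v := by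
  rcases eq_or_ne v 0 with rfl | hv
  · simp
  · exact (h.pos v hv).le

theorem linSasaki_nonneg (h : IsMetricPair G S) (x : E × (E →L[ℝ] ℝ)) : 0 ≤ linSasaki G S x x :=
  add_nonneg (h.nonneg _) (h.nonneg _)

theorem eq_zero_of_linSasaki (h : IsMetricPair G S) {x : E × (E →L[ℝ] ℝ)}
    (hx : linSasaki G S x x = 0) : x = 0 := by
  have h1 := h.nonneg x.1
  have h2 := h.nonneg (S x.2)
  unfold linSasaki at hx
  have h3 : x.1 = 0 := h.eq_zero (by linarith)
  have h4 : S x.2 = 0 := h.eq_zero (by linarith)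
  refine Prod.ext h3 ?_
  rw [← h.right x.2, h4, map_zero]
  rfl

/-- Orthogonal decomposition with respect to `V`. -/
theorem exists_proj [FiniteDimensional ℝ E] (h : IsMetricPair G S) (V : Submodule ℝ E) (w : E) :
    ∃ τ ∈ V, ∀ v ∈ V, G (w - τ) v = 0 := by
  let f : V →ₗ[ℝ] Module.Dual ℝ V :=
    { toFun := fun v => ((G v : E →L[ℝ] ℝ) : E →ₗ[ℝ] ℝ).comp V.subtype
      map_add' := fun v w => by ext; simp
      map_smul' := fun c v => by ext; simp }
  have hinj : Function.Injective f := by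
    rw [injective_iff_map_eq_zero]
    intro v hv
    exact Subtype.ext (h.eq_zero (LinearMap.congr_fun hv v))
  obtain ⟨τ, hτ⟩ := (LinearMap.injective_iff_surjective_of_finrank_eq_finrank
    Subspace.dual_finrank_eq.symm).1 hinj (((G w : E →L[ℝ] ℝ) : E →ₗ[ℝ] ℝ).comp V.subtype)
  refine ⟨τ, τ.2, fun v hv => ?_⟩
  have : G τ v = G w v := LinearMap.congr_fun hτ ⟨v, hv⟩
  simp [this]

end IsMetricPair

theorem contDiffOn_hessOp {ζ : ℝ → E × (E →L[ℝ] ℝ)} (hζ : ContDiffOn ℝ ∞ ζ (Icc (0 : ℝ) 1)) :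
    ContDiffOn ℝ ∞ (hessOp G S ζ) (Icc (0 : ℝ) 1) :=
  (S.contDiff.comp_contDiffOn (contDiffOn_dt hζ).snd).prodMk
    (hζ.snd.sub (G.contDiff.comp_contDiffOn (contDiffOn_dt hζ).fst))

/-- Adding the total derivative of `b₁(a₂)` removes the derivative of `ζ₂` from the integrand. Its
integral is zero because at both ends `b₁ ∈ V⁰` and `a₂ ∈ V`. -/
theorem IsAdm.linHess_eq (h : IsMetricPair G S) {ζ₁ ζ₂ : ℝ → E × (E →L[ℝ] ℝ)}
    (h₁ : IsAdm V ζ₁) (h₂ : IsAdm V ζ₂) :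
    linHess S ζ₁ ζ₂ = ∫ t in Icc (0 : ℝ) 1, linSasaki G S (hessOp G S ζ₁ t) (ζ₂ t) := by
  have hf : ContDiffOn ℝ ∞ (fun t => (ζ₁ t).2 (ζ₂ t).1) (Icc (0 : ℝ) 1) :=
    h₁.1.snd.clm_apply h₂.1.fst
  have hd : ∀ t ∈ Icc (0 : ℝ) 1, dt (fun t => (ζ₁ t).2 (ζ₂ t).1) t =
      (dt ζ₁ t).2 (ζ₂ t).1 + (ζ₁ t).2 (dt ζ₂ t).1 := by
    intro t ht
    have e₁ := (ContinuousLinearMap.snd ℝ E (E →L[ℝ] ℝ)).hasFDerivAt.comp_hasDerivWithinAt t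
      (hasDerivWithinAt_dt h₁.1 ht)
    have e₂ := (ContinuousLinearMap.fst ℝ E (E →L[ℝ] ℝ)).hasFDerivAt.comp_hasDerivWithinAt t
      (hasDerivWithinAt_dt h₂.1 ht)
    exact dt_eq ht (e₁.clm_apply e₂)
  have hz : ∫ t in Icc (0 : ℝ) 1, dt (fun t => (ζ₁ t).2 (ζ₂ t).1) t = 0 := by
    rw [integral_dt hf, h₁.2.2.2 _ h₂.2.2.1, h₁.2.1.2 _ h₂.2.1.1, sub_zero]
  have hI : IntegrableOn (fun t => -((ζ₁ t).2 (dt ζ₂ t).1 + (ζ₂ t).2 (dt ζ₁ t).1) +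
      (ζ₁ t).2 (S (ζ₂ t).2)) (Icc (0 : ℝ) 1) := by
    refine ContinuousOn.integrableOn_Icc (ContDiffOn.continuousOn (n := ∞) (𝕜 := ℝ) ?_)
    exact ((h₁.1.snd.clm_apply (contDiffOn_dt h₂.1).fst).add
      (h₂.1.snd.clm_apply (contDiffOn_dt h₁.1).fst)).neg.add
      (h₁.1.snd.clm_apply (S.contDiff.comp_contDiffOn h₂.1.snd))
  have hI' : IntegrableOn (dt fun t => (ζ₁ t).2 (ζ₂ t).1) (Icc (0 : ℝ) 1) :=
    (contDiffOn_dt hf).continuousOn.integrableOn_Icc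
  have hsum := integral_add hI hI'
  rw [hz, add_zero] at hsum
  rw [linHess, ← hsum]
  refine setIntegral_congr_fun measurableSet_Icc fun t ht => ?_
  simp only [hd t ht, linSasaki, hessOp]
  rw [h.right, h.symm _ (S (ζ₂ t).2), h.right]
  simp only [map_sub, h.left]
  rw [h.apply_comm]
  ring

/-- The kernel of the second variation consists of constant fields tangent to the zero section. -/
theorem IsAdm.eq_const (h : IsMetricPair G S) {ζ : ℝ → E × (E →L[ℝ] ℝ)} (hζ : IsAdm V ζ)
    (hker : ∀ ζ₂, IsAdm V ζ₂ → linHess S ζ ζ₂ = 0) :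
    ∃ v ∈ V, ∀ t ∈ Icc (0 : ℝ) 1, ζ t = (v, 0) := by
  have hop := contDiffOn_hessOp (G := G) (S := S) hζ.1
  -- The weight `t(1 - t)` vanishes at both ends, so the weighted field `hessOp ζ` is admissible
  -- whatever its boundary values, and it is positive inside, so testing against it forces `hessOp ζ
  -- = 0`.
  have hw : ContDiff ℝ ∞ fun t : ℝ => t * (1 - t) := by fun_prop
  have hadm : IsAdm V fun t => (t * (1 - t)) • hessOp G S ζ t :=
    ⟨hw.contDiffOn.smul hop, by simp, by simp⟩
  have h0 := hker _ hadm
  rw [IsAdm.linHess_eq h hζ hadm] at h0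
  have hform : ∀ t, linSasaki G S (hessOp G S ζ t) ((t * (1 - t)) • hessOp G S ζ t) =
      (t * (1 - t)) * linSasaki G S (hessOp G S ζ t) (hessOp G S ζ t) := by
    intro t
    simp [linSasaki, mul_add]
  simp only [hform] at h0
  have hsas : ContinuousOn (fun t => linSasaki G S (hessOp G S ζ t) (hessOp G S ζ t))
      (Icc (0 : ℝ) 1) := by
    have h1 := (G.contDiff.comp_contDiffOn hop.fst).clm_apply hop.fst
    have h2 := S.contDiff.comp_contDiffOn hop.snd
    exact (h1.add ((G.contDiff.comp_contDiffOn h2).clm_apply h2)).continuousOn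
  have hcont := hw.continuous.continuousOn.mul hsas
  have hae := (setIntegral_eq_zero_iff_of_nonneg_ae
    (ae_restrict_of_forall_mem measurableSet_Icc fun t ht =>
      mul_nonneg (mul_nonneg ht.1 (sub_nonneg.2 ht.2)) (h.linSasaki_nonneg _))
    hcont.integrableOn_Icc).1 h0
  have heq := Measure.eqOn_Icc_of_ae_eq volume zero_ne_one hae hcont continuousOn_const
  have hIoo : EqOn (hessOp G S ζ) 0 (Ioo (0 : ℝ) 1) := by
    intro t ht
    have := heq (Ioo_subset_Icc_self ht)
    simp only [Pi.zero_apply, mul_eq_zero] at this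
    rcases this with (h1 | h1) | h1
    · exact absurd h1 ht.1.ne'
    · exact absurd h1 (sub_pos.2 ht.2).ne'
    · exact h.eq_zero_of_linSasaki h1
  have hIcc : EqOn (hessOp G S ζ) 0 (Icc (0 : ℝ) 1) :=
    hIoo.of_subset_closure hop.continuousOn continuousOn_const Ioo_subset_Icc_self
      (by rw [closure_Ioo zero_ne_one])
  have hb : ∀ t ∈ Icc (0 : ℝ) 1, (dt ζ t).2 = 0 := by
    intro t ht
    have := congrArg (fun z => G z.1) (hIcc ht)
    simpa [hessOp, h.right] using this
  have ha : ∀ t ∈ Icc (0 : ℝ) 1, (dt ζ t).1 = S (ζ t).2 := by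
    intro t ht
    have : (ζ t).2 - G (dt ζ t).1 = 0 := congrArg Prod.snd (hIcc ht)
    rw [sub_eq_zero.1 this, h.left]
  have hfst : ∀ t ∈ Icc (0 : ℝ) 1,
      HasDerivWithinAt (fun t => (ζ t).1) (dt ζ t).1 (Icc (0 : ℝ) 1) t := fun t ht =>
    (ContinuousLinearMap.fst ℝ E (E →L[ℝ] ℝ)).hasFDerivAt.comp_hasDerivWithinAt t
      (hasDerivWithinAt_dt hζ.1 ht)
  have hsnd : ∀ t ∈ Icc (0 : ℝ) 1, (ζ t).2 = (ζ 0).2 := by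
    refine eq_of_dt_eq_zero hζ.1.snd fun t ht => ?_
    rw [← hb t ht]
    exact dt_eq ht ((ContinuousLinearMap.snd ℝ E (E →L[ℝ] ℝ)).hasFDerivAt.comp_hasDerivWithinAt t
      (hasDerivWithinAt_dt hζ.1 ht))
  have hlin : ∀ t ∈ Icc (0 : ℝ) 1, (ζ t).1 - t • S (ζ 0).2 = (ζ 0).1 - (0 : ℝ) • S (ζ 0).2 := by
    refine eq_of_dt_eq_zero (hζ.1.fst.sub (by fun_prop)) fun t ht => ?_
    have := (hfst t ht).sub
      ((hasDerivAt_id t).smul_const (S (ζ 0).2)).hasDerivWithinAt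
    rw [ha t ht, hsnd t ht, one_smul, sub_self] at this
    exact dt_eq ht this
  -- The displacement of the first component over `[0,1]` equals its constant slope, and both end
  -- points lie in `V`.
  have hS : S (ζ 0).2 ∈ V := by
    have h1 := hlin 1 (right_mem_Icc.2 zero_le_one)
    rw [one_smul, zero_smul, sub_zero] at h1
    rw [show S (ζ 0).2 = (ζ 1).1 - (ζ 0).1 by rw [← h1]; abel]
    exact V.sub_mem hζ.2.2.1 hζ.2.1.1
  have hS0 : S (ζ 0).2 = 0 := h.eq_zero (by rw [h.right]; exact hζ.2.1.2 _ hS)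
  have hb0 : (ζ 0).2 = 0 := by rw [← h.right (ζ 0).2, hS0, map_zero]
  refine ⟨(ζ 0).1, hζ.2.1.1, fun t ht => Prod.ext ?_ ?_⟩
  · simpa [hS0] using hlin t ht
  · rw [hsnd t ht, hb0]

/-- The cokernel of the second variation is the space of constant fields tangent to the
zero section. -/
theorem ae_eq_zero_of_cokernel [FiniteDimensional ℝ E] (h : IsMetricPair G S)
    {η : ℝ → E × (E →L[ℝ] ℝ)} (hη : IntegrableOn η (Icc (0 : ℝ) 1))
    (hcok : ∀ ζ, IsAdm V ζ → ∫ t in Icc (0 : ℝ) 1, linSasaki G S (hessOp G S ζ t) (η t) = 0)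
    (hann : ∀ v ∈ V, ∫ t in Icc (0 : ℝ) 1, G v (η t).1 = 0) :
    ∀ᵐ t ∂volume.restrict (Icc (0 : ℝ) 1), η t = 0 := by
  -- The test function `ψ` need not vanish at `0` or `1`, so the values at `1` of its iterated
  -- primitives `Ψ` and `Φ` have to be corrected to meet the boundary conditions.
  refine ae_eq_zero_of_integral_contDiff_smul_eq_zero hη.integrable.locallyIntegrable
    fun ψ hψ hψc => ?_
  obtain ⟨Ψ, hΨ, hΨd, hΨ0⟩ := exists_primitive hψ
  obtain ⟨Φ, hΦ, hΦd, hΦ0⟩ := exists_primitive hΨ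
  have hint : Integrable (fun t => ψ t • η t) (volume.restrict (Icc (0 : ℝ) 1)) := by
    obtain ⟨C, hC⟩ := hψ.continuous.bounded_above_of_compact_support hψc
    exact hη.integrable.bdd_smul C hψ.continuous.aestronglyMeasurable
      (ae_of_all _ hC)
  have hsnd : (∫ t in Icc (0 : ℝ) 1, ψ t • η t).2 = 0 := by
    refine ContinuousLinearMap.ext fun w => ?_
    obtain ⟨τ, hτ, hν⟩ := h.exists_proj V w
    -- This field has `hessOp ζ = (0, ψ • G w)`. The constant second component lies in `V⁰` because
    -- `w - τ` is orthogonal to `V`, and the linear term makes the final first component `-Ψ(1) τ`,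
    -- which is in `V`.
    let ζ : ℝ → E × (E →L[ℝ] ℝ) := fun t =>
      (t • Ψ 1 • (w - τ) - Ψ t • w, Ψ 1 • G (w - τ))
    have hd : ∀ t, HasDerivAt ζ (Ψ 1 • (w - τ) - ψ t • w, 0) t := by
      intro t
      refine HasDerivAt.prodMk (HasDerivAt.sub ?_ ((hΨd t).smul_const w)) (hasDerivAt_const _ _)
      simpa using (hasDerivAt_id t).smul_const (Ψ 1 • (w - τ))
    have hadm : IsAdm V ζ := by
      refine ⟨?_, ⟨by simp [ζ, hΨ0], fun v hv => ?_⟩, ⟨?_, fun v hv => ?_⟩⟩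
      · exact ContDiff.contDiffOn (by fun_prop)
      · simpa [ζ] using Or.inr (hν v hv)
      · have : (ζ 1).1 = -(Ψ 1 • τ) := by simp [ζ, smul_sub]
        rw [this]
        exact V.neg_mem (V.smul_mem _ hτ)
      · simpa [ζ] using Or.inr (hν v hv)
    have key := hcok ζ hadm
    have hval : ∀ t ∈ Icc (0 : ℝ) 1, linSasaki G S (hessOp G S ζ t) (η t) =
        (ContinuousLinearMap.apply ℝ ℝ w ∘L ContinuousLinearMap.snd ℝ E (E →L[ℝ] ℝ))
          (ψ t • η t) := by
      intro t ht
      have e := dt_eq ht (hd t).hasDerivWithinAt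
      simp only [linSasaki, hessOp, e, ζ]
      have hw : G w (S (η t).2) = (η t).2 w := by rw [h.apply_comm, h.left]
      simp [hw, h.left]
    rw [setIntegral_congr_fun measurableSet_Icc hval, ContinuousLinearMap.integral_comp_comm _ hint]
      at key
    simpa using key
  have hfst : (∫ t in Icc (0 : ℝ) 1, ψ t • η t).1 = 0 := by
    refine h.eq_zero ?_
    set w := (∫ t in Icc (0 : ℝ) 1, ψ t • η t).1 with hw
    obtain ⟨τ, hτ, hν⟩ := h.exists_proj V w
    -- Here the second component is `G` of the derivative of the first, so `hessOp ζ = (ψ • w - Ψ(1)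
    -- • τ, 0)`. The correction by `τ` puts the final covector in `V⁰`. Its contribution to the
    -- integral is killed by `hann`.
    let ζ : ℝ → E × (E →L[ℝ] ℝ) := fun t =>
      (Φ t • w - t • Φ 1 • (w - τ) - (t ^ 2 / 2) • Ψ 1 • τ,
        Ψ t • G w - t • Ψ 1 • G τ - Φ 1 • G (w - τ))
    have hd : ∀ t, HasDerivAt ζ (Ψ t • w - Φ 1 • (w - τ) - t • Ψ 1 • τ,
        ψ t • G w - Ψ 1 • G τ) t := by
      intro t
      refine HasDerivAt.prodMk ?_ ?_
      · refine (((hΦd t).smul_const w).sub ?_).sub ?_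
        · simpa using (hasDerivAt_id t).smul_const (Φ 1 • (w - τ))
        · refine HasDerivAt.smul_const ?_ _
          simpa using (hasDerivAt_pow 2 t).div_const 2
      · refine (((hΨd t).smul_const (G w)).sub ?_).sub_const _
        simpa using (hasDerivAt_id t).smul_const (Ψ 1 • G τ)
    have hadm : IsAdm V ζ := by
      refine ⟨?_, ⟨by simp [ζ, hΦ0], fun v hv => ?_⟩, ⟨?_, fun v hv => ?_⟩⟩
      · exact ContDiff.contDiffOn (by fun_prop)
      · have := hν v hv
        simp only [ζ, hΨ0, zero_smul, zero_sub, sub_zero]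
        simp [-map_sub, this]
      · have : (ζ 1).1 = Φ 1 • τ - (1 / 2 : ℝ) • Ψ 1 • τ := by simp [ζ, smul_sub]
        rw [this]
        exact V.sub_mem (V.smul_mem _ hτ) (V.smul_mem _ (V.smul_mem _ hτ))
      · have := hν v hv
        have e : (ζ 1).2 = Ψ 1 • G (w - τ) - Φ 1 • G (w - τ) := by simp [ζ, smul_sub]
        rw [e]
        simp [-map_sub, this]
    have key := hcok ζ hadm
    have hval : ∀ t ∈ Icc (0 : ℝ) 1, linSasaki G S (hessOp G S ζ t) (η t) =
        (G w ∘L ContinuousLinearMap.fst ℝ E (E →L[ℝ] ℝ)) (ψ t • η t) -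
          Ψ 1 * G τ (η t).1 := by
      intro t ht
      have e := dt_eq ht (hd t).hasDerivWithinAt
      have e₂ : (hessOp G S ζ t).2 = 0 := by
        simp only [hessOp, e]
        simp only [ζ, map_sub, map_smul]
        abel
      have e₁ : (hessOp G S ζ t).1 = ψ t • w - Ψ 1 • τ := by
        simp only [hessOp, e, map_sub, map_smul, h.left]
      rw [linSasaki, e₁, e₂]
      simp
    have hint' : Integrable (fun t => Ψ 1 * G τ (η t).1) (volume.restrict (Icc (0 : ℝ) 1)) :=
      ((G τ ∘L ContinuousLinearMap.fst ℝ E (E →L[ℝ] ℝ)).integrable_comp hη.integrable).const_mul _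
    rw [setIntegral_congr_fun measurableSet_Icc hval,
      integral_sub (ContinuousLinearMap.integrable_comp _ hint) hint',
      ContinuousLinearMap.integral_comp_comm _ hint, integral_const_mul, hann τ hτ] at key
    simpa [← hw] using key
  exact Prod.ext hfst hsnd

end Linear

/-! ### Canonical coordinates on the cotangent bundle -/

section Coordinates

variable {n : ℕ} {N : Type*} [TopologicalSpace N] [ChartedSpace (Model n) N]
  [IsManifold (𝓡 n) ∞ N]

/-- The canonical coordinates of `T*N` induced by the preferred chart of `N` at `q`. -/
abbrev covChart (q : N) : PartialEquiv (Cotangent n N) (CotModel n) :=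
  extChartAt (cotI n) (zeroCov (n := n) q)

/-- The derivative at `y` of the preferred chart at `q`. -/
def chartD (q y : N) : Model n →L[ℝ] Model n :=
  (trivializationAt (Model n) (TangentSpace (𝓡 n)) q).continuousLinearMapAt ℝ y

/-- The inverse of the derivative at `y` of the preferred chart at `q`. -/
def chartDsymm (q y : N) : Model n →L[ℝ] Model n :=
  (trivializationAt (Model n) (TangentSpace (𝓡 n)) q).symmL ℝ y

/-- A covector as a linear form on the model space. -/
def covec (x : Cotangent n N) : Model n →L[ℝ] ℝ := x.2

theorem chartD_symm {q y : N} (hy : y ∈ (chartAt (Model n) q).source) (v : Model n) :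
    chartD q y (chartDsymm q y v) = v :=
  (trivializationAt (Model n) (TangentSpace (𝓡 n)) q).continuousLinearMapAt_symmL (R := ℝ)
    (by simpa using hy) v

theorem chartDsymm_chartD {q y : N} (hy : y ∈ (chartAt (Model n) q).source)
    (v : Model n) : chartDsymm q y (chartD q y v) = v :=
  (trivializationAt (Model n) (TangentSpace (𝓡 n)) q).symmL_continuousLinearMapAt (R := ℝ)
    (by simpa using hy) (show TangentSpace (𝓡 n) y from v)

theorem chartD_eq_mfderiv {q y : N} (hy : y ∈ (chartAt (Model n) q).source) :
    chartD q y = mfderiv (𝓡 n) 𝓘(ℝ, Model n) (extChartAt (𝓡 n) q) y :=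
  TangentBundle.continuousLinearMapAt_trivializationAt hy

theorem chartD_self (q : N) (v : Model n) : chartD q q v = v := by
  rw [chartD_eq_mfderiv (mem_chart_source _ q), mfderiv_extChartAt_self]
  rfl

theorem covChart_source (q : N) :
    (covChart q).source = {x : Cotangent n N | x.1 ∈ (chartAt (Model n) q).source} := by
  ext x
  rw [covChart, FiberBundle.extChartAt]
  simp [zeroCov, hom_trivializationAt_apply]

theorem covChart_target (q : N) :
    (covChart q).target = (chartAt (Model n) q).target ×ˢ (univ : Set (Model n →L[ℝ] ℝ)) := by
  rw [covChart, FiberBundle.extChartAt_target]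
  ext x
  simp [zeroCov]
  intro h
  exact (chartAt (Model n) q).map_target h

theorem covChart_fst (q : N) (x : Cotangent n N) :
    (covChart q x).1 = chartAt (Model n) q x.1 := by
  rw [covChart, FiberBundle.extChartAt]
  simp [zeroCov, hom_trivializationAt_apply]

theorem covChart_snd_apply (q : N) (x : Cotangent n N) (v : Model n) :
    (covChart q x).2 v = covec x (chartDsymm q x.1 v) := by
  rw [covChart, FiberBundle.extChartAt]
  simp [covec, chartDsymm, zeroCov, hom_trivializationAt_apply, ContinuousLinearMap.inCoordinates]
  rfl

theorem covChart_snd_chartD {q : N} {x : Cotangent n N}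
    (hx : x.1 ∈ (chartAt (Model n) q).source) (w : Model n) :
    (covChart q x).2 (chartD q x.1 w) = covec x w := by
  rw [covChart_snd_apply, chartDsymm_chartD hx]

theorem covChart_zeroCov (q y : N) : covChart q (zeroCov y) = (chartAt (Model n) q y, 0) := by
  refine Prod.ext (covChart_fst q _) ?_
  ext v
  rw [covChart_snd_apply]
  rfl

/-- The Liouville form in canonical coordinates. -/
theorem liouville_eq {q : N} {x : Cotangent n N} (hx : x.1 ∈ (chartAt (Model n) q).source)
    (ζ : TangentSpace (cotI n) x) :
    liouville x ζ =
      (covChart q x).2 (mfderiv (cotI n) 𝓘(ℝ, CotModel n) (covChart q) x ζ : CotModel n).1 := by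
  have hπ : MDifferentiableAt (cotI n) (𝓡 n) (fun y : Cotangent n N => y.1) x :=
    (contMDiff_proj (n := 1) _).mdifferentiable one_ne_zero x
  have hc : MDifferentiableAt (𝓡 n) 𝓘(ℝ, Model n) (extChartAt (𝓡 n) q) x.1 :=
    mdifferentiableAt_extChartAt hx
  have hxs : x ∈ (covChart q).source := by rw [covChart_source]; exact hx
  have hΨ : MDifferentiableAt (cotI n) 𝓘(ℝ, CotModel n) (covChart q) x :=
    mdifferentiableAt_extChartAt (by simpa [extChartAt_source] using hxs)
  have h1 := mfderiv_comp x hc hπ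
  have hfst : MDifferentiableAt 𝓘(ℝ, CotModel n) 𝓘(ℝ, Model n) (Prod.fst : CotModel n → Model n)
      (covChart q x) := differentiableAt_fst.mdifferentiableAt
  have h2 := mfderiv_comp x hfst hΨ
  have heq : (extChartAt (𝓡 n) q ∘ fun y : Cotangent n N => y.1) =
      (Prod.fst : CotModel n → Model n) ∘ covChart q := by
    funext y
    exact (covChart_fst q y).symm
  rw [heq, h2] at h1
  have h3 := congrArg (fun L => L ζ) h1
  refine (covChart_snd_chartD hx _).symm.trans ?_
  rw [chartD_eq_mfderiv hx]
  congr 1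
  refine Eq.trans h3.symm ?_
  rw [mfderiv_eq_fderiv, fderiv_fst]
  rfl

end Coordinates

/-! ### The kinetic energy in canonical coordinates -/

section Kinetic

variable {n : ℕ} {N : Type*} [TopologicalSpace N] [ChartedSpace (Model n) N]
  [IsManifold (𝓡 n) ∞ N] (g : RiemMetric n N)

/-- The metric at `q` as a bilinear form on the model space. -/
def metricAt (q : N) : Model n →L[ℝ] Model n →L[ℝ] ℝ := g.inner q

theorem metricAt_injective (q : N) : Function.Injective (metricAt g q) := by
  rw [injective_iff_map_eq_zero]
  intro v hv
  by_contra h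
  have h1 : 0 < metricAt g q v v := g.pos q v h
  rw [hv] at h1
  exact lt_irrefl _ h1

/-- The vector dual to a linear form on the model space for the metric at `q`. -/
def sharpAt (q : N) (α : Model n →L[ℝ] ℝ) : Model n := sharp g q α

theorem metricAt_sharpAt (q : N) (α : Model n →L[ℝ] ℝ) : metricAt g q (sharpAt g q α) = α :=
  inner_sharp g q α

/-- The musical isomorphism at `q` as a linear map on the model space. -/
def sharpL (q : N) : (Model n →L[ℝ] ℝ) →L[ℝ] Model n :=
  LinearMap.toContinuousLinearMap
    { toFun := sharpAt g q
      map_add' := fun α β => metricAt_injective g q (by simp [metricAt_sharpAt])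
      map_smul' := fun c α => metricAt_injective g q (by simp [metricAt_sharpAt]) }

theorem isMetricPair (q : N) : IsMetricPair (metricAt g q) (sharpL g q) where
  symm := g.symm q
  pos := g.pos q
  right := inner_sharp g q

theorem kinetic_eq (x : Cotangent n N) :
    kinetic g x = (1 / 2) * covec x (sharpL g x.1 (covec x)) := by
  rw [kinetic, inner_sharp]
  rfl

/-- The inverse trivialisation applied to a constant vector is a smooth local vector field. Pairing
two such fields gives the matrix entries of the metric in the chart. -/
theorem contMDiffOn_inner_frame (q : N) (v w : Model n) :
    ContMDiffOn (𝓡 n) 𝓘(ℝ, ℝ) ∞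
      (fun y => metricAt g y (chartDsymm q y v) (chartDsymm q y w)) (chartAt (Model n) q).source := by
  intro y hy
  have hs : ∀ v : Model n, ContMDiffAt (𝓡 n) (𝓡 n).tangent ∞
      (fun y => (⟨y, chartDsymm q y v⟩ : TangentBundle (𝓡 n) N)) y := by
    intro v
    have h1 : ContMDiffAt (𝓡 n) ((𝓡 n).prod 𝓘(ℝ, Model n →L[ℝ] Model n)) ∞ (fun m : N =>
        TotalSpace.mk' (Model n →L[ℝ] Model n) (E := fun m : N =>
          Bundle.Trivial N (Model n) m →L[ℝ] TangentSpace (𝓡 n) m) m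
          ((trivializationAt (Model n) (TangentSpace (𝓡 n)) q).symmL ℝ m)) y :=
      (trivializationAt (Model n) (TangentSpace (𝓡 n)) q).contMDiffAt_symmL (by simpa using hy)
    have h2 : ContMDiffAt (𝓡 n) ((𝓡 n).prod 𝓘(ℝ, Model n)) ∞ (fun m : N =>
        TotalSpace.mk' (Model n) (E := Bundle.Trivial N (Model n)) m v) y := by
      rw [contMDiffAt_totalSpace]
      exact ⟨contMDiffAt_id, contMDiffAt_const⟩
    exact ContMDiffAt.clm_bundle_apply (F₁ := Model n) (F₂ := Model n)
      (E₁ := Bundle.Trivial N (Model n)) (E₂ := fun m : N => TangentSpace (𝓡 n) m)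
      (b := fun m : N => m) (v := fun _ => v)
      (ϕ := fun m =>
        (trivializationAt (Model n) (TangentSpace (𝓡 n)) q).symmL ℝ m) h1 h2
  have h := ContMDiffAt.clm_bundle_apply₂ (F₁ := Model n) (F₂ := Model n) (F₃ := ℝ)
    (E₁ := fun m : N => TangentSpace (𝓡 n) m) (E₂ := fun m : N => TangentSpace (𝓡 n) m)
    (E₃ := Bundle.Trivial N ℝ) (b := fun y : N => y)
    (v := fun y => (chartDsymm q y v : TangentSpace (𝓡 n) y))
    (w := fun y => (chartDsymm q y w : TangentSpace (𝓡 n) y))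
    (ψ := fun y => g.inner y) (g.contMDiff y) (hs v) (hs w)
  rw [contMDiffAt_totalSpace] at h
  exact h.2.contMDiffWithinAt

/-- The metric in the preferred chart at `q`. -/
def localMetric (q : N) (z : Model n) : Model n →L[ℝ] Model n →L[ℝ] ℝ :=
  (ContinuousLinearMap.compL ℝ (Model n) (Model n) ℝ).flip
      (chartDsymm q ((chartAt (Model n) q).symm z)) ∘L
    metricAt g ((chartAt (Model n) q).symm z) ∘L chartDsymm q ((chartAt (Model n) q).symm z)

theorem contDiffOn_localMetric (q : N) :
    ContDiffOn ℝ ∞ (localMetric g q) (chartAt (Model n) q).target := by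
  rw [contDiffOn_clm_apply]
  intro v
  rw [contDiffOn_clm_apply]
  intro w
  rw [← contMDiffOn_iff_contDiffOn]
  exact (contMDiffOn_inner_frame g q v w).comp contMDiffOn_chart_symm
    fun z hz => (chartAt (Model n) q).map_target hz

/-- The dual metric in the preferred chart at `q`. -/
def localSharp (q : N) (z : Model n) : (Model n →L[ℝ] ℝ) →L[ℝ] Model n :=
  (localMetric g q z).inverse

/-- The dual metric transported by the chart is a two-sided inverse of the transported metric.
Invertibility is recorded because `inverse` takes a default value otherwise and is smooth only at
invertible maps. -/
theorem localSharp_eq {q : N} {z : Model n} (hz : z ∈ (chartAt (Model n) q).target)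
    (α : Model n →L[ℝ] ℝ) : localSharp g q z α =
      chartD q ((chartAt (Model n) q).symm z) (sharpL g ((chartAt (Model n) q).symm z)
        (α ∘L chartD q ((chartAt (Model n) q).symm z))) ∧
    (localMetric g q z).IsInvertible := by
  have hy := (chartAt (Model n) q).map_target hz
  set y := (chartAt (Model n) q).symm z with hy'
  let A : Model n →L[ℝ] Model n := chartD q y
  let R : (Model n →L[ℝ] ℝ) →L[ℝ] Model n :=
    A ∘L sharpL g y ∘L (ContinuousLinearMap.compL ℝ (Model n) (Model n) ℝ).flip A
  have hR : (localMetric g q z) ∘L R = ContinuousLinearMap.id ℝ _ := by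
    ext α v
    change metricAt g y (chartDsymm q y (chartD q y (sharpL g y (α ∘L A)))) (chartDsymm q y v) = α v
    rw [chartDsymm_chartD hy, (isMetricPair g y).right]
    exact congrArg α (chartD_symm hy v)
  have hL : R ∘L (localMetric g q z) = ContinuousLinearMap.id ℝ _ := by
    refine ContinuousLinearMap.ext fun v => ?_
    have : (localMetric g q z v) ∘L A = metricAt g y (chartDsymm q y v) := by
      refine ContinuousLinearMap.ext fun w => ?_
      change metricAt g y (chartDsymm q y v) (chartDsymm q y (chartD q y w)) = _
      rw [chartDsymm_chartD hy]
    change A (sharpL g y ((localMetric g q z v) ∘L A)) = v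
    rw [this, (isMetricPair g y).left]
    exact chartD_symm hy v
  refine ⟨?_, ContinuousLinearMap.IsInvertible.of_inverse hR hL⟩
  rw [localSharp, ContinuousLinearMap.inverse_eq hR hL]
  rfl

theorem contDiffOn_localSharp (q : N) :
    ContDiffOn ℝ ∞ (localSharp g q) (chartAt (Model n) q).target := by
  intro z hz
  exact ((localSharp_eq g hz 0).2.contDiffAt_map_inverse).comp_contDiffWithinAt z
    (contDiffOn_localMetric g q z hz)

theorem localSharp_self (q : N) : localSharp g q (chartAt (Model n) q q) = sharpL g q := by
  refine ContinuousLinearMap.ext fun α => ?_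
  rw [(localSharp_eq g ((chartAt (Model n) q).map_source (mem_chart_source _ q)) α).1,
    (chartAt (Model n) q).left_inv (mem_chart_source _ q)]
  have h : (α ∘L chartD q q : Model n →L[ℝ] ℝ) = α := by
    refine ContinuousLinearMap.ext fun v => ?_
    exact congrArg α (chartD_self q v)
  rw [h]
  exact chartD_self q _

theorem kinetic_eq_local {q : N} {x : Cotangent n N} (hx : x.1 ∈ (chartAt (Model n) q).source) :
    kinetic g x = (1 / 2) * (covChart q x).2 (localSharp g q (covChart q x).1 (covChart q x).2) := by
  have hα : ((covChart q x).2 ∘L chartD q x.1 : Model n →L[ℝ] ℝ) = covec x :=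
    ContinuousLinearMap.ext fun v => covChart_snd_chartD hx v
  rw [kinetic_eq, covChart_fst, (localSharp_eq g ((chartAt (Model n) q).map_source hx) _).1,
    (chartAt (Model n) q).left_inv hx, hα, covChart_snd_chartD hx]

theorem contMDiff_kinetic : ContMDiff (cotI n) 𝓘(ℝ, ℝ) ∞ (kinetic g) := by
  intro x
  have hs : {y : Cotangent n N | y.1 ∈ (chartAt (Model n) x.1).source} ∈ 𝓝 x := by
    rw [← covChart_source]
    exact extChartAt_source_mem_nhds' (by rw [covChart_source]; exact mem_chart_source _ x.1)
  have h1 : ContMDiffAt (cotI n) 𝓘(ℝ, CotModel n) ∞ (covChart x.1) x :=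
    contMDiffAt_extChartAt' (by
      have : x ∈ (covChart x.1).source := by rw [covChart_source]; exact mem_chart_source _ x.1
      simpa [extChartAt_source] using this)
  have h2 : ContDiffAt ℝ ∞ (fun z : CotModel n => (1 / 2 : ℝ) * z.2 (localSharp g x.1 z.1 z.2))
      (covChart x.1 x) := by
    have h3 : ContDiffAt ℝ ∞ (localSharp g x.1) (covChart x.1 x).1 := by
      refine (contDiffOn_localSharp g x.1).contDiffAt
        ((chartAt (Model n) x.1).open_target.mem_nhds ?_)
      rw [covChart_fst]
      exact mem_chart_target _ _
    exact contDiffAt_const.mul (contDiffAt_snd.clm_apply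
      ((h3.comp _ contDiffAt_fst).clm_apply contDiffAt_snd))
  refine (h2.contMDiffAt.comp x h1).congr_of_eventuallyEq ?_
  filter_upwards [hs] with y hy
  exact kinetic_eq_local g hy

end Kinetic

/-! ### Velocities in charts -/

section Velocity

variable {F : Type*} [NormedAddCommGroup F] [NormedSpace ℝ F]
  {H : Type*} [TopologicalSpace H] {J : ModelWithCorners ℝ F H}
  {M : Type*} [TopologicalSpace M] [ChartedSpace H M] [IsManifold J ∞ M]

/-- The chart derivative is invertible, so an equation in the tangent bundle is equivalent to one
between ordinary derivatives in any chart around the point. -/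
theorem curveVelocity_eq_iff {c : ℝ → M} {s : ℝ} (hc : ContMDiffAt 𝓘(ℝ, ℝ) J ∞ c s) {x x₀ : M}
    (hx : x ∈ (chartAt H x₀).source) (v : TangentSpace J x) :
    curveVelocity J c s = (⟨x, v⟩ : TangentBundle J M) ↔
      c s = x ∧ HasDerivAt (extChartAt J x₀ ∘ c) (mfderiv J 𝓘(ℝ, F) (extChartAt J x₀) x v : F) s := by
  have : IsManifold J 1 M := .of_le (n := ∞) (by simp)
  have hcm := (hc.mdifferentiableAt (by simp)).hasMFDerivAt
  have key : c s = x → HasDerivAt (extChartAt J x₀ ∘ c)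
      (mfderiv J 𝓘(ℝ, F) (extChartAt J x₀) (c s) (mfderiv 𝓘(ℝ, ℝ) J c s (1 : ℝ)) : F) s := by
    intro h
    have h1 := (mdifferentiableAt_extChartAt (x := x₀) (y := c s)
      (by rw [h]; exact hx)).hasMFDerivAt.comp s hcm
    let L : ℝ →L[ℝ] F :=
      (mfderiv J 𝓘(ℝ, F) (extChartAt J x₀) (c s)).comp (mfderiv 𝓘(ℝ, ℝ) J c s)
    have h2 : HasFDerivAt (extChartAt J x₀ ∘ c) L s := h1.hasFDerivAt
    exact h2.hasDerivAt
  constructor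
  · intro h
    have h0 : c s = x := congrArg TotalSpace.proj h
    refine ⟨h0, ?_⟩
    subst h0
    have : v = mfderiv 𝓘(ℝ, ℝ) J c s (1 : ℝ) := by
      rw [curveVelocity, TotalSpace.mk_inj] at h
      exact h.symm
    rw [this]
    exact key rfl
  · rintro ⟨rfl, h⟩
    rw [curveVelocity, TotalSpace.mk_inj]
    have hinv : (mfderiv J 𝓘(ℝ, F) (extChartAt J x₀) (c s)).IsInvertible :=
      isInvertible_mfderiv_extChartAt (by rwa [extChartAt_source])
    exact hinv.injective ((key rfl).unique h)

/-- The preferred chart has identity derivative at its own centre, so a tangent vector is literally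
its coordinate vector. -/
theorem curveVelocity_eq_iff_self {c : ℝ → M} {s : ℝ} (hc : ContMDiffAt 𝓘(ℝ, ℝ) J ∞ c s) {x : M}
    (v : TangentSpace J x) :
    curveVelocity J c s = (⟨x, v⟩ : TangentBundle J M) ↔
      c s = x ∧ HasDerivAt (extChartAt J x ∘ c) (v : F) s := by
  have : IsManifold J 1 M := .of_le (n := ∞) (by simp)
  rw [curveVelocity_eq_iff hc (mem_chart_source H x) v, mfderiv_extChartAt_self]
  rfl

end Velocity

/-- The difference quotients lie in `V`, which is closed by finite dimension. -/
theorem hasDerivAt_mem_submodule {W : Type*} [NormedAddCommGroup W] [NormedSpace ℝ W]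
    [FiniteDimensional ℝ W] {V : Submodule ℝ W} {f : ℝ → W} {f' : W} {s : ℝ}
    (hf : HasDerivAt f f' s) (hV : ∀ᶠ r in 𝓝 s, f r ∈ V) : f' ∈ V := by
  have hV' := hV.filter_mono (nhdsWithin_le_nhds (s := {s}ᶜ))
  refine V.closed_of_finiteDimensional.mem_of_tendsto (hasDerivAt_iff_tendsto_slope.1 hf) ?_
  filter_upwards [hV'] with r hr
  exact V.smul_mem _ (V.sub_mem hr hV.self_of_nhds)

/-! ### Slice charts and the conormal bundle -/

section Slice

variable {n : ℕ} {N : Type*} [TopologicalSpace N] [ChartedSpace (Model n) N]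

/-- A change of the preferred chart at `q` which straightens `T` to the linear subspace `V` and
is tangent to the identity. -/
structure SliceChart (T : Set N) (q : N) (V : Submodule ℝ (Model n)) where
  /-- The change of coordinates. -/
  chg : OpenPartialHomeomorph (Model n) (Model n)
  mem : chartAt (Model n) q q ∈ chg.source
  subset : chg.source ⊆ (chartAt (Model n) q).target
  smooth : ContDiffOn ℝ ∞ chg chg.source
  smooth_symm : ContDiffOn ℝ ∞ chg.symm chg.target
  map_base : chg (chartAt (Model n) q q) = 0
  deriv_base : fderiv ℝ chg (chartAt (Model n) q q) = ContinuousLinearMap.id ℝ _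
  mem_iff : ∀ x ∈ chg.source, (chartAt (Model n) q).symm x ∈ T ↔ chg x ∈ V

theorem fderiv_symm_comp_fderiv {E : Type*} [NormedAddCommGroup E] [NormedSpace ℝ E]
    {τ : OpenPartialHomeomorph E E} (h : ContDiffOn ℝ ∞ τ τ.source)
    (h' : ContDiffOn ℝ ∞ τ.symm τ.target) {x : E} (hx : x ∈ τ.source) :
    fderiv ℝ τ.symm (τ x) ∘L fderiv ℝ τ x = ContinuousLinearMap.id ℝ E := by
  have h1 : DifferentiableAt ℝ τ x :=
    (h.contDiffAt (τ.open_source.mem_nhds hx)).differentiableAt (by simp)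
  have h2 : DifferentiableAt ℝ τ.symm (τ x) :=
    (h'.contDiffAt (τ.open_target.mem_nhds (τ.map_source hx))).differentiableAt (by simp)
  rw [← fderiv_comp x h2 h1, ← fderiv_id (x := x)]
  refine Filter.EventuallyEq.fderiv_eq ?_
  filter_upwards [τ.open_source.mem_nhds hx] with y hy
  exact τ.left_inv hy

theorem fderiv_comp_fderiv_symm {E : Type*} [NormedAddCommGroup E] [NormedSpace ℝ E]
    {τ : OpenPartialHomeomorph E E} (h : ContDiffOn ℝ ∞ τ τ.source)
    (h' : ContDiffOn ℝ ∞ τ.symm τ.target) {x : E} (hx : x ∈ τ.source) :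
    fderiv ℝ τ x ∘L fderiv ℝ τ.symm (τ x) = ContinuousLinearMap.id ℝ E := by
  have := fderiv_symm_comp_fderiv (τ := τ.symm) h' (by simpa using h) (τ.map_source hx)
  simpa [τ.left_inv hx] using this

variable [IsManifold (𝓡 n) ∞ N]

/-- The transition `τ` from the preferred chart `χ` to a slice chart is composed with `A⁻¹(· - τ(χ
q))`, where `A` is the derivative of `τ` at `χ q`. This centres it at `0` and makes its derivative
the identity. Since `τ(χ q)` lies in the coordinate subspace `W`, the slice condition becomes
membership in `V = A⁻¹ W`. -/
theorem IsSubmanifold.exists_sliceChart {k : ℕ} {T : Set N} (hT : IsSubmanifold n k T) {q : N}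
    (hq : q ∈ T) : ∃ V : Submodule ℝ (Model n), Nonempty (SliceChart T q V) := by
  obtain ⟨φ, hφ, hqφ, hφT⟩ := hT q hq
  set χ := chartAt (Model n) q with hχ
  have hqχ : q ∈ χ.source := mem_chart_source _ q
  have hχa : χ ∈ IsManifold.maximalAtlas (𝓡 n) ∞ N := IsManifold.chart_mem_maximalAtlas q
  let τ : OpenPartialHomeomorph (Model n) (Model n) := χ.symm.trans φ
  have hτ : ContDiffOn ℝ ∞ τ τ.source := by
    rw [← contMDiffOn_iff_contDiffOn]
    refine (contMDiffOn_of_mem_maximalAtlas hφ).comp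
      ((contMDiffOn_symm_of_mem_maximalAtlas hχa).mono ?_) ?_
    · intro x hx
      exact hx.1
    · intro x hx
      exact hx.2
  have hτ' : ContDiffOn ℝ ∞ τ.symm τ.target := by
    rw [← contMDiffOn_iff_contDiffOn]
    refine (contMDiffOn_of_mem_maximalAtlas hχa).comp
      ((contMDiffOn_symm_of_mem_maximalAtlas hφ).mono ?_) ?_
    · intro x hx
      exact hx.1
    · intro x hx
      exact hx.2
  have hx0 : χ q ∈ τ.source := by
    refine ⟨χ.map_source hqχ, ?_⟩
    simpa [χ.left_inv hqχ] using hqφ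
  let A : Model n ≃L[ℝ] Model n := ContinuousLinearEquiv.equivOfInverse
    (fderiv ℝ τ (χ q)) (fderiv ℝ τ.symm (τ (χ q)))
    (fun v => congrArg (fun L => L v) (fderiv_symm_comp_fderiv hτ hτ' hx0))
    (fun v => congrArg (fun L => L v) (fderiv_comp_fderiv_symm hτ hτ' hx0))
  let W : Submodule ℝ (Model n) :=
    { carrier := {v | ∀ i : Fin n, k ≤ (i : ℕ) → v i = 0}
      add_mem' := fun h1 h2 i hi => by simp [h1 i hi, h2 i hi]
      zero_mem' := fun i _ => rfl
      smul_mem' := fun c v h i hi => by simp [h i hi] }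
  have hτT : ∀ x ∈ τ.source, χ.symm x ∈ T ↔ τ x ∈ W := by
    intro x hx
    exact hφT _ hx.2
  have h0W : τ (χ q) ∈ W := by
    rw [← hτT _ hx0, χ.left_inv hqχ]
    exact hq
  let h : Model n ≃ₜ Model n := (Homeomorph.subRight (τ (χ q))).trans A.symm.toHomeomorph
  have hh : ∀ w, h w = A.symm (w - τ (χ q)) := fun w => rfl
  have hh' : ∀ w, h.symm w = A w + τ (χ q) := fun w => rfl
  have hhs : ContDiff ℝ ∞ h := A.symm.contDiff.comp (contDiff_id.sub contDiff_const)
  refine ⟨W.comap (A : Model n →L[ℝ] Model n).toLinearMap,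
    ⟨⟨τ.transHomeomorph h, hx0, fun x hx => hx.1, ?_, ?_, ?_, ?_, ?_⟩⟩⟩
  · exact hhs.comp_contDiffOn hτ
  · exact hτ'.comp ((A.contDiff.add contDiff_const).contDiffOn) fun w hw => hw
  · simp [hh, ← hχ]
  · have h1 : HasFDerivAt (fun x => A.symm (τ x - τ (χ q)))
        ((A.symm : Model n →L[ℝ] Model n) ∘L fderiv ℝ τ (χ q)) (χ q) := by
      have hd : DifferentiableAt ℝ τ (χ q) :=
        (hτ.contDiffAt (τ.open_source.mem_nhds hx0)).differentiableAt (by simp)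
      exact A.symm.hasFDerivAt.comp _ (hd.hasFDerivAt.sub_const _)
    refine h1.fderiv.trans ?_
    exact ContinuousLinearMap.ext fun v => A.symm_apply_apply v
  · intro x hx
    rw [hτT x hx]
    change _ ↔ A (A.symm (τ x - τ (χ q))) ∈ W
    rw [A.apply_symm_apply]
    exact ⟨fun h => W.sub_mem h h0W, fun h => by simpa using W.add_mem h h0W⟩

namespace SliceChart

variable {T : Set N} {q : N} {V : Submodule ℝ (Model n)} (s : SliceChart T q V)

/-- In slice coordinates a curve in `T` takes values in `V`, hence so does its derivative.
Conversely a straight line in a direction of `V` comes from a curve in `T`. -/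
theorem isTangentTo_iff {y : N} (hy : y ∈ (chartAt (Model n) q).source)
    (hyσ : chartAt (Model n) q y ∈ s.chg.source) (hyT : y ∈ T) (v : TangentSpace (𝓡 n) y) :
    IsTangentTo (𝓡 n) T y v ↔
      fderiv ℝ s.chg (chartAt (Model n) q y) (chartD q y v) ∈ V := by
  set χ := chartAt (Model n) q with hχ
  have hσd : HasFDerivAt s.chg (fderiv ℝ s.chg (χ y)) (χ y) :=
    ((s.smooth.contDiffAt (s.chg.open_source.mem_nhds hyσ)).differentiableAt (by simp)).hasFDerivAt
  constructor
  · rintro ⟨c, U, hU, h0, hc, hcT, hv⟩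
    have hcs := hc.contMDiffAt (hU.mem_nhds h0)
    obtain ⟨hc0, hcd⟩ := (curveVelocity_eq_iff hcs hy v).1 hv
    rw [← chartD_eq_mfderiv hy] at hcd
    have hd : HasDerivAt (s.chg ∘ (extChartAt (𝓡 n) q ∘ c))
        (fderiv ℝ s.chg (χ y) (chartD q y v)) 0 := by
      refine HasFDerivAt.comp_hasDerivAt (0 : ℝ) ?_ hcd
      simpa [hc0] using hσd
    refine hasDerivAt_mem_submodule hd ?_
    have h1 : ∀ᶠ r in 𝓝 (0 : ℝ), c r ∈ χ.source := by
      refine hcs.continuousAt.eventually_mem (χ.open_source.mem_nhds ?_)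
      rwa [hc0]
    have h2 : ∀ᶠ r in 𝓝 (0 : ℝ), extChartAt (𝓡 n) q (c r) ∈ s.chg.source := by
      refine hcd.continuousAt.eventually_mem (s.chg.open_source.mem_nhds ?_)
      simpa [hc0] using hyσ
    filter_upwards [h1, h2, hU.mem_nhds h0] with r hr1 hr2 hr3
    refine (s.mem_iff _ hr2).1 ?_
    have := χ.left_inv hr1
    simpa [this, ← hχ] using hcT r hr3
  · intro hv
    set w := fderiv ℝ s.chg (χ y) (chartD q y v) with hw
    have hlin : Continuous fun r : ℝ => s.chg (χ y) + r • w := by fun_prop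
    have hyV : s.chg (χ y) ∈ V := by
      rw [← s.mem_iff _ hyσ, χ.left_inv hy]
      exact hyT
    set U := (fun r : ℝ => s.chg (χ y) + r • w) ⁻¹' s.chg.target with hUdef
    have hU : IsOpen U := s.chg.open_target.preimage hlin
    have h0 : (0 : ℝ) ∈ U := by simpa [hUdef] using s.chg.map_source hyσ
    have hin : ContDiffOn ℝ ∞ (fun r : ℝ => s.chg.symm (s.chg (χ y) + r • w)) U :=
      s.smooth_symm.comp (by fun_prop) fun r hr => hr
    have hc : ContMDiffOn 𝓘(ℝ, ℝ) (𝓡 n) ∞ (fun r => χ.symm (s.chg.symm (s.chg (χ y) + r • w))) U :=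
      contMDiffOn_chart_symm.comp hin.contMDiffOn fun r hr => s.subset (s.chg.map_target hr)
    refine ⟨_, U, hU, h0, hc, ?_, ?_⟩
    · intro r hr
      rw [s.mem_iff _ (s.chg.map_target hr), s.chg.right_inv hr]
      exact V.add_mem hyV (V.smul_mem _ hv)
    · rw [curveVelocity_eq_iff (hc.contMDiffAt (hU.mem_nhds h0)) hy v, ← chartD_eq_mfderiv hy]
      refine ⟨by simp [s.chg.left_inv hyσ, χ.left_inv hy], ?_⟩
      have hσ' : HasFDerivAt s.chg.symm (fderiv ℝ s.chg.symm (s.chg (χ y))) (s.chg (χ y) + (0 : ℝ) • w) := by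
        rw [zero_smul, add_zero]
        exact ((s.smooth_symm.contDiffAt (s.chg.open_target.mem_nhds
          (s.chg.map_source hyσ))).differentiableAt (by simp)).hasFDerivAt
      have hl : HasDerivAt (fun r : ℝ => s.chg (χ y) + r • w) w 0 := by
        simpa using ((hasDerivAt_id (0 : ℝ)).smul_const w).const_add (s.chg (χ y))
      have hd := hσ'.comp_hasDerivAt (0 : ℝ) hl
      have hwv : fderiv ℝ s.chg.symm (s.chg (χ y)) w = chartD q y v :=
        congrArg (fun L => L (chartD q y v)) (fderiv_symm_comp_fderiv s.smooth s.smooth_symm hyσ)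
      rw [hwv] at hd
      refine hd.congr_of_eventuallyEq ?_
      filter_upwards [hU.mem_nhds h0] with r hr
      exact χ.right_inv (s.subset (s.chg.map_target hr))

theorem isTangentTo_base_iff (s : SliceChart T q V) (hq : q ∈ T) (v : TangentSpace (𝓡 n) q) :
    IsTangentTo (𝓡 n) T q v ↔ (v : Model n) ∈ V := by
  rw [s.isTangentTo_iff (mem_chart_source _ q) s.mem hq v, s.deriv_base]
  exact iff_of_eq (congrArg (· ∈ V) (chartD_self q v))

/-- The conormal bundle in canonical coordinates. -/
theorem mem_conormal_iff {x : Cotangent n N} (hx : x.1 ∈ (chartAt (Model n) q).source)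
    (hxσ : (covChart q x).1 ∈ s.chg.source) :
    x ∈ conormal T ↔ s.chg (covChart q x).1 ∈ V ∧
      ∀ v, fderiv ℝ s.chg (covChart q x).1 v ∈ V → (covChart q x).2 v = 0 := by
  rw [covChart_fst] at hxσ ⊢
  have hT : x.1 ∈ T ↔ s.chg (chartAt (Model n) q x.1) ∈ V := by
    rw [← s.mem_iff _ hxσ, (chartAt (Model n) q).left_inv hx]
  rw [← hT]
  refine and_congr_right fun hxT => ⟨fun h v hv => ?_, fun h v hv => ?_⟩
  · rw [covChart_snd_apply]
    refine h _ ((s.isTangentTo_iff hx hxσ hxT _).2 ?_)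
    rwa [chartD_symm hx]
  · have := h _ ((s.isTangentTo_iff hx hxσ hxT v).1 hv)
    exact (covChart_snd_chartD hx v).symm.trans this

end SliceChart

end Slice

/-! ### Straightening the conormal bundle -/

section Straightening

variable {n : ℕ} {N : Type*} [TopologicalSpace N] [ChartedSpace (Model n) N]

/-- The product rule term that differentiates `D` is multiplied by the covector, which is zero.
Hence a cotangent lift of a map tangent to the identity is itself tangent to the identity on the
zero covector. -/
theorem hasFDerivAt_snd_comp {E : Type*} [NormedAddCommGroup E] [NormedSpace ℝ E]
    {D : E × (E →L[ℝ] ℝ) → E →L[ℝ] E} {z : E × (E →L[ℝ] ℝ)} (hD : DifferentiableAt ℝ D z)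
    (hz : z.2 = 0) (hDz : D z = ContinuousLinearMap.id ℝ E) :
    HasFDerivAt (fun y : E × (E →L[ℝ] ℝ) => y.2 ∘L D y)
      (ContinuousLinearMap.snd ℝ E (E →L[ℝ] ℝ)) z := by
  refine ((hasFDerivAt_snd (𝕜 := ℝ) (p := z)).clm_comp hD.hasFDerivAt).congr_fderiv ?_
  refine ContinuousLinearMap.ext fun y => ContinuousLinearMap.ext fun v => ?_
  change z.2 (fderiv ℝ D z y v) + y.2 (D z v) = y.2 v
  rw [hz, hDz]
  simp

namespace SliceChart

variable {T : Set N} {q : N} {V : Submodule ℝ (Model n)} (s : SliceChart T q V)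

theorem contDiffOn_fderiv : ContDiffOn ℝ ∞ (fderiv ℝ s.chg) s.chg.source :=
  s.smooth.fderiv_of_isOpen s.chg.open_source (by simp)

theorem contDiffOn_fderiv_symm : ContDiffOn ℝ ∞ (fderiv ℝ s.chg.symm) s.chg.target :=
  s.smooth_symm.fderiv_of_isOpen s.chg.open_target (by simp)

theorem zero_mem_target : (0 : Model n) ∈ s.chg.target := by
  rw [← s.map_base]
  exact s.chg.map_source s.mem

theorem symm_zero : s.chg.symm 0 = chartAt (Model n) q q := by
  rw [← s.map_base, s.chg.left_inv s.mem]

theorem fderiv_symm_zero : fderiv ℝ s.chg.symm 0 = ContinuousLinearMap.id ℝ _ := by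
  have := fderiv_symm_comp_fderiv s.smooth s.smooth_symm s.mem
  rwa [s.deriv_base, s.map_base, ContinuousLinearMap.comp_id] at this

/-- The parametrisation of the cotangent bundle, in canonical coordinates, which maps the linear
conormal space of `V` to the conormal bundle. -/
def lift (z : CotModel n) : CotModel n :=
  (s.chg.symm z.1, z.2 ∘L fderiv ℝ s.chg (s.chg.symm z.1))

/-- The inverse of `SliceChart.lift`. -/
def unlift (z : CotModel n) : CotModel n :=
  (s.chg z.1, z.2 ∘L fderiv ℝ s.chg.symm (s.chg z.1))

theorem contDiffOn_lift : ContDiffOn ℝ ∞ s.lift (s.chg.target ×ˢ univ) := by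
  have h1 : ContDiffOn ℝ ∞ (fun z : CotModel n => s.chg.symm z.1) (s.chg.target ×ˢ univ) :=
    s.smooth_symm.comp contDiffOn_fst fun z hz => hz.1
  exact h1.prodMk (contDiffOn_snd.clm_comp
    (s.contDiffOn_fderiv.comp h1 fun z hz => s.chg.map_target hz.1))

theorem lift_zero : s.lift 0 = (chartAt (Model n) q q, 0) := by
  simp [lift, s.symm_zero]

theorem hasFDerivAt_lift : HasFDerivAt s.lift (ContinuousLinearMap.id ℝ (CotModel n)) 0 := by
  have h0 : (0 : CotModel n).1 = 0 := rfl
  have h1 : HasFDerivAt s.chg.symm (ContinuousLinearMap.id ℝ _) (0 : CotModel n).1 := by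
    rw [h0, ← s.fderiv_symm_zero]
    exact ((s.smooth_symm.contDiffAt (s.chg.open_target.mem_nhds
      s.zero_mem_target)).differentiableAt (by simp)).hasFDerivAt
  have h2 : HasFDerivAt (fun z : CotModel n => s.chg.symm z.1)
      (ContinuousLinearMap.id ℝ _ ∘L ContinuousLinearMap.fst ℝ _ _) 0 :=
    h1.comp (0 : CotModel n) hasFDerivAt_fst
  have h3 : DifferentiableAt ℝ (fun z : CotModel n => fderiv ℝ s.chg (s.chg.symm z.1)) 0 := by
    have h4 : DifferentiableAt ℝ (fderiv ℝ s.chg) (s.chg.symm (0 : CotModel n).1) := by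
      rw [h0, s.symm_zero]
      exact (s.contDiffOn_fderiv.contDiffAt (s.chg.open_source.mem_nhds s.mem)).differentiableAt
        (by simp)
    exact h4.comp (0 : CotModel n) h2.differentiableAt
  have h5 := hasFDerivAt_snd_comp h3 rfl (by
    change fderiv ℝ s.chg (s.chg.symm 0) = _
    rw [s.symm_zero, s.deriv_base])
  exact (h2.prodMk h5).congr_fderiv (ContinuousLinearMap.ext fun z => rfl)

theorem hasFDerivAt_unlift : HasFDerivAt s.unlift (ContinuousLinearMap.id ℝ (CotModel n))
    (chartAt (Model n) q q, 0) := by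
  set z₀ : CotModel n := (chartAt (Model n) q q, 0)
  have h1 : HasFDerivAt s.chg (ContinuousLinearMap.id ℝ _) z₀.1 := by
    rw [← s.deriv_base]
    exact ((s.smooth.contDiffAt (s.chg.open_source.mem_nhds s.mem)).differentiableAt
      (by simp)).hasFDerivAt
  have h2 : HasFDerivAt (fun z : CotModel n => s.chg z.1)
      (ContinuousLinearMap.id ℝ _ ∘L ContinuousLinearMap.fst ℝ _ _) z₀ :=
    h1.comp z₀ hasFDerivAt_fst
  have h3 : DifferentiableAt ℝ (fun z : CotModel n => fderiv ℝ s.chg.symm (s.chg z.1)) z₀ := by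
    have h4 : DifferentiableAt ℝ (fderiv ℝ s.chg.symm) (s.chg z₀.1) := by
      exact (s.contDiffOn_fderiv_symm.contDiffAt (s.chg.open_target.mem_nhds
        (s.chg.map_source s.mem))).differentiableAt (by simp)
    exact h4.comp z₀ h2.differentiableAt
  have h5 := hasFDerivAt_snd_comp h3 rfl (by
    change fderiv ℝ s.chg.symm (s.chg (chartAt (Model n) q q)) = _
    rw [s.map_base, s.fderiv_symm_zero])
  exact (h2.prodMk h5).congr_fderiv (ContinuousLinearMap.ext fun z => rfl)

variable [IsManifold (𝓡 n) ∞ N]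

theorem lift_mem_target {z : CotModel n} (hz : z.1 ∈ s.chg.target) :
    s.lift z ∈ (covChart q).target := by
  rw [covChart_target]
  exact ⟨s.subset (s.chg.map_target hz), mem_univ _⟩

theorem lift_mem_conormal {z : CotModel n} (hz : z.1 ∈ s.chg.target) (hzV : z ∈ linConormal V) :
    (covChart q).symm (s.lift z) ∈ conormal T := by
  have ht := s.lift_mem_target hz
  have hs := (covChart q).map_target ht
  rw [covChart_source] at hs
  have hr := (covChart q).right_inv ht
  rw [s.mem_conormal_iff hs (by rw [hr]; exact s.chg.map_target hz), hr]
  refine ⟨?_, fun v hv => hzV.2 _ hv⟩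
  change s.chg (s.chg.symm z.1) ∈ V
  rw [s.chg.right_inv hz]
  exact hzV.1

theorem unlift_mem {x : Cotangent n N} (hx : x.1 ∈ (chartAt (Model n) q).source)
    (hxσ : (covChart q x).1 ∈ s.chg.source) (hxT : x ∈ conormal T) :
    s.unlift (covChart q x) ∈ linConormal V := by
  obtain ⟨h1, h2⟩ := (s.mem_conormal_iff hx hxσ).1 hxT
  refine ⟨h1, fun v hv => h2 _ ?_⟩
  have := congrArg (fun L => L v) (fderiv_comp_fderiv_symm s.smooth s.smooth_symm hxσ)
  change fderiv ℝ s.chg _ (fderiv ℝ s.chg.symm _ v) = v at this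
  exact (congrArg (· ∈ V) this).mpr hv

/-- The tangent space of the conormal bundle at a point of the zero section. -/
theorem isTangentTo_conormal_iff (s : SliceChart T q V) (ζ : CotModel n) :
    IsTangentTo (cotI n) (conormal T) (zeroCov (n := n) q) ζ ↔ ζ ∈ linConormal V := by
  constructor
  · rintro ⟨c, U, hU, h0, hc, hcT, hv⟩
    have hcs := hc.contMDiffAt (hU.mem_nhds h0)
    obtain ⟨hc0, hcd⟩ := (curveVelocity_eq_iff_self hcs ζ).1 hv
    have hb : (covChart q ∘ c) 0 = (chartAt (Model n) q q, 0) := by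
      rw [Function.comp_apply, hc0, covChart_zeroCov]
    -- Passing to straightened coordinates does not change the derivative at the zero covector, and
    -- there the curve stays in the linear space `V × V⁰`.
    have hd : HasDerivAt (s.unlift ∘ (covChart q ∘ c)) ζ 0 := by
      refine HasFDerivAt.comp_hasDerivAt (0 : ℝ) (l' := ContinuousLinearMap.id ℝ _) ?_ hcd
      rw [hb]
      exact s.hasFDerivAt_unlift
    refine hasDerivAt_mem_submodule hd ?_
    have h1 : ∀ᶠ r in 𝓝 (0 : ℝ), c r ∈ (covChart q).source := by
      refine hcs.continuousAt.eventually_mem ?_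
      rw [hc0]
      exact extChartAt_source_mem_nhds _
    have h2 : ∀ᶠ r in 𝓝 (0 : ℝ), (covChart q (c r)).1 ∈ s.chg.source := by
      refine (continuous_fst.continuousAt.comp hcd.continuousAt).eventually_mem
        (s.chg.open_source.mem_nhds ?_)
      change ((covChart q ∘ c) 0).1 ∈ _
      rw [hb]
      exact s.mem
    filter_upwards [h1, h2, hU.mem_nhds h0] with r hr1 hr2 hr3
    rw [covChart_source] at hr1
    exact s.unlift_mem hr1 hr2 (hcT r hr3)
  · intro hζ
    have hlin : Continuous fun r : ℝ => (r • ζ).1 := by fun_prop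
    set U := (fun r : ℝ => (r • ζ).1) ⁻¹' s.chg.target with hUdef
    have hU : IsOpen U := s.chg.open_target.preimage hlin
    have h0 : (0 : ℝ) ∈ U := by simpa [hUdef] using s.zero_mem_target
    have hin : ContDiffOn ℝ ∞ (fun r : ℝ => s.lift (r • ζ)) U :=
      s.contDiffOn_lift.comp (by fun_prop) fun r hr => ⟨hr, mem_univ _⟩
    have hc : ContMDiffOn 𝓘(ℝ, ℝ) (cotI n) ∞ (fun r => (covChart q).symm (s.lift (r • ζ))) U :=
      (contMDiffOn_extChartAt_symm _).comp hin.contMDiffOn fun r hr => s.lift_mem_target hr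
    refine ⟨_, U, hU, h0, hc, fun r hr => s.lift_mem_conormal hr ((linConormal V).smul_mem r hζ), ?_⟩
    refine (curveVelocity_eq_iff_self (hc.contMDiffAt (hU.mem_nhds h0)) _).2 ⟨?_, ?_⟩
    · simp only [zero_smul]
      rw [s.lift_zero, ← covChart_zeroCov, (covChart q).left_inv (mem_extChartAt_source _)]
    · have hl : HasDerivAt (fun r : ℝ => r • ζ) ζ 0 := by
        simpa using (hasDerivAt_id (0 : ℝ)).smul_const ζ
      have hd : HasDerivAt (s.lift ∘ fun r : ℝ => r • ζ) ζ 0 := by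
        refine HasFDerivAt.comp_hasDerivAt (0 : ℝ) (l' := ContinuousLinearMap.id ℝ _) ?_ hl
        rw [zero_smul]
        exact s.hasFDerivAt_lift
      refine hd.congr_of_eventuallyEq ?_
      filter_upwards [hU.mem_nhds h0] with r hr
      exact (covChart q).right_inv (s.lift_mem_target hr)

end SliceChart

end Straightening

/-! ### Vector fields along a constant path -/

section Fields

theorem trivializationAt_tangent_self {F : Type*} [NormedAddCommGroup F] [NormedSpace ℝ F]
    {H : Type*} [TopologicalSpace H] {J : ModelWithCorners ℝ F H}
    {M : Type*} [TopologicalSpace M] [ChartedSpace H M] (x : M)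
    [IsManifold J 1 M] (v : TangentSpace J x) :
    (trivializationAt F (TangentSpace J) x (⟨x, v⟩ : TangentBundle J M)).2 = v := by
  rw [TangentBundle.trivializationAt_apply]
  exact tangentCoordChange_self (mem_extChartAt_source x)

variable {n : ℕ} {N : Type*} [TopologicalSpace N] [ChartedSpace (Model n) N]
  [IsManifold (𝓡 n) ∞ N]

/-- A vector field along a constant path, extended to the line. -/
def fieldExt {q : N} (ξ : Fields n q) : ℝ → CotModel n :=
  IccExtend (zero_le_one (α := ℝ)) (fun t => (ξ t : CotModel n))

theorem fieldExt_coe {q : N} (ξ : Fields n q) (t : I) : fieldExt ξ t = ξ t :=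
  IccExtend_val _ _ t

/-- The base point never moves, so a single fibre is involved, and the trivialisation centred at
that point is the identity on it. -/
theorem smoothPath_constPath_iff {q : N} (ξ : Fields n q) :
    SmoothPath (cotI n).tangent
      (fun t => (⟨constPath n q t, ξ t⟩ : TangentBundle (cotI n) (Cotangent n N))) ↔
      ContDiffOn ℝ ∞ (fieldExt ξ) (Icc (0 : ℝ) 1) := by
  rw [← contMDiffOn_iff_contDiffOn]
  refine forall₂_congr fun t ht => ?_
  rw [contMDiffWithinAt_totalSpace]
  have h1 : ContMDiffWithinAt 𝓘(ℝ, ℝ) (cotI n) ∞ (fun t : ℝ => (IccExtend (zero_le_one (α := ℝ))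
      (fun t => (⟨constPath n q t, ξ t⟩ : TangentBundle (cotI n) (Cotangent n N))) t).proj)
      (Icc 0 1) t := contMDiffWithinAt_const
  have h2 : (fun r : ℝ => (trivializationAt (CotModel n) (TangentSpace (cotI n))
      (IccExtend (zero_le_one (α := ℝ))
        (fun t => (⟨constPath n q t, ξ t⟩ : TangentBundle (cotI n) (Cotangent n N))) t).proj
      (IccExtend (zero_le_one (α := ℝ))
        (fun t => (⟨constPath n q t, ξ t⟩ : TangentBundle (cotI n) (Cotangent n N))) r)).2) =
      fieldExt ξ := by
    funext r
    exact trivializationAt_tangent_self (zeroCov q) _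
  rw [h2]
  exact and_iff_right h1

theorem SliceChart.mem_pathTangent_iff {T : Set N} {q : N} {V : Submodule ℝ (Model n)}
    (s : SliceChart T q V) (ξ : Fields n q) :
    ξ ∈ pathTangent (cotI n) (conormal T) (constPath n q) ↔ IsAdm V (fieldExt ξ) := by
  refine and_congr (smoothPath_constPath_iff ξ) (and_congr ?_ ?_)
  · rw [show fieldExt ξ 0 = ξ 0 from fieldExt_coe ξ 0]
    exact s.isTangentTo_conormal_iff _
  · rw [show fieldExt ξ 1 = ξ 1 from fieldExt_coe ξ 1]
    exact s.isTangentTo_conormal_iff _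

/-- Every pair of tangent vectors of the path space is realised by a two-parameter variation. -/
theorem SliceChart.exists_isVariation {T : Set N} {q : N} {V : Submodule ℝ (Model n)}
    (s : SliceChart T q V) {ξ₁ ξ₂ : Fields n q}
    (h₁ : ξ₁ ∈ pathTangent (cotI n) (conormal T) (constPath n q))
    (h₂ : ξ₂ ∈ pathTangent (cotI n) (conormal T) (constPath n q)) :
    ∃ Γ, IsVariation (cotI n) (conormal T) (constPath n q) ξ₁ ξ₂ Γ := by
  rw [s.mem_pathTangent_iff] at h₁ h₂
  -- The variation is linear in the straightened coordinates: end points stay in the linear space `V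
  -- × V⁰`, which `lift` maps into the conormal bundle.
  let L : (ℝ × ℝ) × ℝ → CotModel n := fun z => z.1.1 • fieldExt ξ₁ z.2 + z.1.2 • fieldExt ξ₂ z.2
  have hL : ContDiffOn ℝ ∞ L (univ ×ˢ Icc (0 : ℝ) 1) := by
    have hs : MapsTo (Prod.snd : (ℝ × ℝ) × ℝ → ℝ) (univ ×ˢ Icc (0 : ℝ) 1) (Icc 0 1) :=
      fun z hz => hz.2
    exact ((contDiff_fst.fst.contDiffOn).smul (h₁.1.comp contDiffOn_snd hs)).add
      ((contDiff_fst.snd.contDiffOn).smul (h₂.1.comp contDiffOn_snd hs))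
  obtain ⟨U, hU, h0, hUL⟩ : ∃ U : Set (ℝ × ℝ), IsOpen U ∧ (0, 0) ∈ U ∧
      ∀ z ∈ U, ∀ t ∈ Icc (0 : ℝ) 1, (L (z, t)).1 ∈ s.chg.target := by
    -- Compactness of `[0,1]` gives one parameter neighbourhood for all times. The repeated
    -- membership of `t` is needed since the local statements concern full neighbourhoods of `((0,
    -- 0), t)`, which may leave `[0,1]`.
    have key : ∀ᶠ z in 𝓝 ((0, 0) : ℝ × ℝ), ∀ t ∈ Icc (0 : ℝ) 1,
        t ∈ Icc (0 : ℝ) 1 → (L (z, t)).1 ∈ s.chg.target := by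
      refine isCompact_Icc.eventually_forall_of_forall_eventually fun t ht => ?_
      have h1 : ContinuousWithinAt (fun z => (L z).1) (univ ×ˢ Icc (0 : ℝ) 1) ((0, 0), t) :=
        (hL.continuousOn.fst) _ ⟨mem_univ _, ht⟩
      have h2 : s.chg.target ∈ 𝓝 (L ((0, 0), t)).1 := by
        simpa [L] using s.chg.open_target.mem_nhds s.zero_mem_target
      filter_upwards [mem_nhdsWithin_iff_eventually.1 (h1.preimage_mem_nhdsWithin h2)] with z hz hzt
      exact hz ⟨mem_univ _, hzt⟩
    obtain ⟨U, hU1, hU2, hU3⟩ := eventually_nhds_iff.1 key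
    exact ⟨U, hU2, hU3, fun z hz t ht => hU1 z hz t ht ht⟩
  let Γ : ℝ × ℝ → I → Cotangent n N := fun z t => (covChart q).symm (s.lift (L (z, t)))
  have hsm : SmoothFamilyOn (cotI n) U Γ := by
    have h1 : ContDiffOn ℝ ∞ (fun z => s.lift (L z)) (U ×ˢ Icc (0 : ℝ) 1) :=
      s.contDiffOn_lift.comp (hL.mono (prod_mono_left (subset_univ _)))
        fun z hz => ⟨hUL z.1 hz.1 z.2 hz.2, mem_univ _⟩
    refine ((contMDiffOn_extChartAt_symm _).comp h1.contMDiffOn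
      fun z hz => s.lift_mem_target (hUL z.1 hz.1 z.2 hz.2)).congr fun z hz => ?_
    rw [IccExtend_of_mem _ _ hz.2]
    rfl
  have hcurve : ∀ (a : ℝ → ℝ × ℝ) (t : I) (ζ : CotModel n), ContDiff ℝ ∞ a → a 0 = (0, 0) →
      (∀ r, L (a r, t) = r • ζ) →
      curveVelocity (cotI n) (fun r => Γ (a r) t) 0 =
        (⟨constPath n q t, ζ⟩ : TangentBundle (cotI n) (Cotangent n N)) := by
    intro a t ζ ha ha0 haL
    have hta : ∀ᶠ r in 𝓝 (0 : ℝ), a r ∈ U :=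
      ha.continuous.continuousAt.eventually_mem (hU.mem_nhds (by rwa [ha0]))
    have hin : ContDiffAt ℝ ∞ (fun r => s.lift (L (a r, t))) 0 := by
      simp only [haL]
      have h1 : ContDiffAt ℝ ∞ s.lift ((0 : ℝ) • ζ) := by
        rw [zero_smul]
        exact s.contDiffOn_lift.contDiffAt
          ((s.chg.open_target.prod isOpen_univ).mem_nhds ⟨s.zero_mem_target, mem_univ _⟩)
      have h2 : ContDiffAt ℝ ∞ (fun r : ℝ => r • ζ) 0 := by fun_prop
      exact ContDiffAt.comp (0 : ℝ) h1 h2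
    have h0t : s.lift (L (a 0, t)) ∈ (covChart q).target :=
      s.lift_mem_target (hUL _ (by rwa [ha0]) t t.2)
    have hcm : ContMDiffAt 𝓘(ℝ, ℝ) (cotI n) ∞ (fun r => Γ (a r) t) 0 :=
      ((contMDiffOn_extChartAt_symm _).contMDiffAt ((isOpen_extChartAt_target _).mem_nhds h0t)).comp
        (0 : ℝ) hin.contMDiffAt
    refine (curveVelocity_eq_iff_self hcm _).2 ⟨?_, ?_⟩
    · change (covChart q).symm (s.lift (L (a 0, t))) = zeroCov q
      rw [haL, zero_smul, s.lift_zero, ← covChart_zeroCov,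
        (covChart q).left_inv (mem_extChartAt_source _)]
    · have hl : HasDerivAt (fun r : ℝ => L (a r, t)) ζ 0 := by
        simp only [haL]
        simpa using (hasDerivAt_id (0 : ℝ)).smul_const ζ
      have hd : HasDerivAt (s.lift ∘ fun r : ℝ => L (a r, t)) ζ 0 := by
        refine HasFDerivAt.comp_hasDerivAt (0 : ℝ) (l' := ContinuousLinearMap.id ℝ _) ?_ hl
        rw [haL, zero_smul]
        exact s.hasFDerivAt_lift
      refine hd.congr_of_eventuallyEq ?_
      filter_upwards [hta] with r hr
      exact (covChart q).right_inv (s.lift_mem_target (hUL _ hr t t.2))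
  have hend : ∀ z ∈ U, ∀ t : I, fieldExt ξ₁ t ∈ linConormal V → fieldExt ξ₂ t ∈ linConormal V →
      Γ z t ∈ conormal T := fun z hz t e₁ e₂ =>
    s.lift_mem_conormal (hUL z hz t t.2) ((linConormal V).add_mem
      ((linConormal V).smul_mem _ e₁) ((linConormal V).smul_mem _ e₂))
  refine ⟨Γ, ⟨U, hU, h0, hsm, fun z hz =>
    ⟨hend z hz 0 h₁.2.1 h₂.2.1, hend z hz 1 h₁.2.2 h₂.2.2⟩⟩, fun t => ?_, fun t => ?_⟩
  · refine hcurve (fun r => (r, 0)) t (ξ₁ t) (by fun_prop) rfl fun r => ?_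
    change r • fieldExt ξ₁ t + (0 : ℝ) • fieldExt ξ₂ t = r • ξ₁ t
    rw [zero_smul, add_zero, fieldExt_coe]
    rfl
  · refine hcurve (fun r => (0, r)) t (ξ₂ t) (by fun_prop) rfl fun r => ?_
    change (0 : ℝ) • fieldExt ξ₁ t + r • fieldExt ξ₂ t = r • ξ₂ t
    rw [zero_smul, zero_add, fieldExt_coe]
    rfl

end Fields

/-! ### The second variation of the action -/

section Hessian

theorem fderivWithin_time {E W : Type*} [NormedAddCommGroup E] [NormedSpace ℝ E]
    [NormedAddCommGroup W] [NormedSpace ℝ W] {U : Set E} {h : E × ℝ → W} {z : E} {t : ℝ}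
    (hz : z ∈ U)
    (hh : DifferentiableWithinAt ℝ h (U ×ˢ Icc (0 : ℝ) 1) (z, t)) :
    HasDerivWithinAt (fun r => h (z, r)) (fderivWithin ℝ h (U ×ˢ Icc (0 : ℝ) 1) (z, t) (0, 1))
      (Icc (0 : ℝ) 1) t := by
  have hl : HasDerivWithinAt (fun r : ℝ => (z, r)) ((0 : E), (1 : ℝ)) (Icc (0 : ℝ) 1) t :=
    ((hasDerivAt_const t z).prodMk (hasDerivAt_id t)).hasDerivWithinAt
  exact hh.hasFDerivWithinAt.comp_hasDerivWithinAt t hl fun r hr => ⟨hz, hr⟩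

variable {n : ℕ} {N : Type*} [TopologicalSpace N] [ChartedSpace (Model n) N]
  [IsManifold (𝓡 n) ∞ N]

theorem liouville_velocity {q : N} {γ : I → Cotangent n N} {t : I}
    (hγ : MDifferentiableWithinAt 𝓘(ℝ, ℝ) (cotI n) (IccExtend (zero_le_one (α := ℝ)) γ) (Icc 0 1) t)
    (ht : γ t ∈ (covChart q).source) {d : CotModel n}
    (hd : HasDerivWithinAt (covChart q ∘ IccExtend (zero_le_one (α := ℝ)) γ) d (Icc 0 1) t) :
    liouville (γ t) (velocity (cotI n) γ t) = (covChart q (γ t)).2 d.1 := by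
  have ht' := ht
  rw [covChart_source] at ht'
  rw [liouville_eq ht']
  congr 2
  set c := IccExtend (zero_le_one (α := ℝ)) γ with hc
  have hct : c t = γ t := IccExtend_val _ _ t
  have h1 : MDifferentiableAt (cotI n) 𝓘(ℝ, CotModel n) (covChart q) (c t) := by
    rw [hct]
    refine mdifferentiableAt_extChartAt ?_
    rwa [extChartAt_source] at ht
  have h2 := h1.hasMFDerivAt.comp_hasMFDerivWithinAt _ hγ.hasMFDerivWithinAt
  let L : ℝ →L[ℝ] CotModel n := (mfderiv (cotI n) 𝓘(ℝ, CotModel n) (covChart q) (c t)).comp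
    (mfderivWithin 𝓘(ℝ, ℝ) (cotI n) c (Icc 0 1) t)
  have h3 : HasFDerivWithinAt (covChart q ∘ c) L (Icc 0 1) t := h2.hasFDerivWithinAt
  have h4 := (uniqueDiffOn_Icc zero_lt_one (t : ℝ) t.2).eq_deriv _ h3.hasDerivWithinAt hd
  have h5 : (mfderiv (cotI n) 𝓘(ℝ, CotModel n) (covChart q) (γ t) : CotModel n →L[ℝ] CotModel n) =
      mfderiv (cotI n) 𝓘(ℝ, CotModel n) (covChart q) (c t) := by rw [hct]
  refine Eq.trans ?_ h4
  exact congrArg (fun A : CotModel n →L[ℝ] CotModel n =>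
    A (mfderivWithin 𝓘(ℝ, ℝ) (cotI n) c (Icc 0 1) t (1 : ℝ))) h5

theorem integral_unitInterval (f : ℝ → ℝ) : ∫ t : I, f t = ∫ t in Icc (0 : ℝ) 1, f t :=
  integral_subtype measurableSet_Icc f

variable (g : RiemMetric n N)

/-- The second variation of the action at the constant path at `q`. -/
def secondVariation (q : N) (ξ₁ ξ₂ : Fields n q) : ℝ :=
  linHess (sharpL g q) (fieldExt ξ₁) (fieldExt ξ₂)

/-- The action of a family of paths inside a canonical coordinate chart. -/
theorem action_eq {q : N} {U : Set (ℝ × ℝ)} {Γ : ℝ × ℝ → I → Cotangent n N}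
    (hΓ : SmoothFamilyOn (cotI n) U Γ)
    (hsrc : ∀ z ∈ U, ∀ t : I, Γ z t ∈ (covChart q).source)
    {Z : (ℝ × ℝ) × ℝ → CotModel n}
    (hZ : Z = fun p => covChart q (IccExtend (zero_le_one (α := ℝ)) (Γ p.1) p.2))
    (hZs : ContDiffOn ℝ ∞ Z (U ×ˢ Icc (0 : ℝ) 1)) {z : ℝ × ℝ} (hz : z ∈ U) :
    action g (Γ z) = -(∫ t in Icc (0 : ℝ) 1, (Z (z, t)).2
        (fderivWithin ℝ Z (U ×ˢ Icc (0 : ℝ) 1) (z, t) (0, 1)).1) +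
      ∫ t in Icc (0 : ℝ) 1, ((1 / 2 : ℝ) • (Z (z, t)).2) (localSharp g q (Z (z, t)).1 (Z (z, t)).2) := by
  have hZt : ∀ t : I, Z (z, t) = covChart q (Γ z t) := by
    intro t
    rw [hZ]
    simp only [IccExtend_val]
  have hcm : ContMDiffOn 𝓘(ℝ, ℝ) (cotI n) ∞ (IccExtend (zero_le_one (α := ℝ)) (Γ z)) (Icc 0 1) :=
    hΓ.comp (f := fun t : ℝ => (z, t)) (contMDiffOn_iff_contDiffOn.2 (by fun_prop))
      fun t ht => ⟨hz, ht⟩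
  rw [action]
  congr 1
  · congr 1
    rw [← integral_unitInterval]
    refine integral_congr_ae (ae_of_all _ fun t => ?_)
    simp only [hZt]
    refine liouville_velocity (hcm.mdifferentiableOn (by simp) t t.2) (hsrc z hz t) ?_
    have := fderivWithin_time hz (hZs.differentiableOn (by simp) (z, (t : ℝ)) ⟨hz, t.2⟩)
    rw [hZ] at this ⊢
    exact this
  · rw [← integral_unitInterval]
    refine integral_congr_ae (ae_of_all _ fun t => ?_)
    simp only [hZt]
    have hs := hsrc z hz t
    rw [covChart_source] at hs
    rw [kinetic_eq_local g hs]
    simp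

/-- Both integrals in `action_eq` pair factors that vanish along the zero covector: `p` with the
base velocity, and `p/2` with the dual of `p`. So `mixed_deriv_integral_pairing` applies to each and
only the variation fields and their time derivatives remain. -/
theorem mixed_deriv_action {L : Set (Cotangent n N)} {q : N} {ξ₁ ξ₂ : Fields n q}
    (hξ₁ : ContDiffOn ℝ ∞ (fieldExt ξ₁) (Icc (0 : ℝ) 1))
    (hξ₂ : ContDiffOn ℝ ∞ (fieldExt ξ₂) (Icc (0 : ℝ) 1)) {Γ : ℝ × ℝ → I → Cotangent n N}
    (hΓ : IsVariation (cotI n) L (constPath n q) ξ₁ ξ₂ Γ) :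
    ∃ A' : ℝ → ℝ, (∀ᶠ s in 𝓝 0, HasDerivAt (fun u => action g (Γ (s, u))) (A' s) 0) ∧
      HasDerivAt A' (secondVariation g q ξ₁ ξ₂) 0 := by
  obtain ⟨⟨U₀, hU₀, h0U₀, hsm₀, -⟩, hv₁, hv₂⟩ := hΓ
  have hΓ0 : ∀ t, Γ (0, 0) t = zeroCov q := fun t => congrArg TotalSpace.proj (hv₁ t)
  obtain ⟨U, hU, h0U, hUU₀, hsrc⟩ : ∃ U : Set (ℝ × ℝ), IsOpen U ∧ (0, 0) ∈ U ∧ U ⊆ U₀ ∧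
      ∀ z ∈ U, ∀ t : I, Γ z t ∈ (covChart q).source := by
    have key : ∀ᶠ z in 𝓝 ((0, 0) : ℝ × ℝ), ∀ t ∈ Icc (0 : ℝ) 1, z ∈ U₀ → t ∈ Icc (0 : ℝ) 1 →
        IccExtend (zero_le_one (α := ℝ)) (Γ z) t ∈ (covChart q).source := by
      refine isCompact_Icc.eventually_forall_of_forall_eventually fun t ht => ?_
      have h1 := hsm₀.continuousOn ((0, 0), t) ⟨h0U₀, ht⟩
      have h2 : (covChart q).source ∈ 𝓝 (IccExtend (zero_le_one (α := ℝ)) (Γ (0, 0)) t) := by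
        have : IccExtend (zero_le_one (α := ℝ)) (Γ (0, 0)) t = zeroCov q := hΓ0 _
        rw [this]
        exact extChartAt_source_mem_nhds _
      filter_upwards [mem_nhdsWithin_iff_eventually.1 (h1.preimage_mem_nhdsWithin h2)]
        with z hz hz1 hz2
      exact hz ⟨hz1, hz2⟩
    obtain ⟨U, hU1, hU2, hU3⟩ := eventually_nhds_iff.1 key
    refine ⟨U ∩ U₀, hU2.inter hU₀, ⟨hU3, h0U₀⟩, inter_subset_right, fun z hz t => ?_⟩
    have := hU1 z hz.1 t t.2 hz.2 t.2
    rwa [IccExtend_val] at this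
  have hsm : SmoothFamilyOn (cotI n) U Γ := hsm₀.mono (prod_mono_left hUU₀)
  have h0 : (0 : ℝ × ℝ) ∈ U := h0U
  set S := U ×ˢ Icc (0 : ℝ) 1 with hS
  obtain ⟨Z, hZ⟩ : ∃ Z : (ℝ × ℝ) × ℝ → CotModel n,
    Z = fun p => covChart q (IccExtend (zero_le_one (α := ℝ)) (Γ p.1) p.2) := ⟨_, rfl⟩
  have hZs : ContDiffOn ℝ ∞ Z S := by
    rw [hZ, ← contMDiffOn_iff_contDiffOn]
    refine (contMDiffOn_extChartAt (x := zeroCov (n := n) q)).comp hsm fun p hp => ?_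
    have := hsrc p.1 hp.1 ⟨p.2, hp.2⟩
    rw [extChartAt_source] at this
    change IccExtend (zero_le_one (α := ℝ)) (Γ p.1) p.2 ∈
      (chartAt (ModelProd (Model n) (Model n →L[ℝ] ℝ)) (zeroCov (n := n) q)).source
    rwa [IccExtend_of_mem _ _ hp.2]
  have hu := uniqueDiffOn_prod_Icc hU
  have hZd : DifferentiableOn ℝ Z S := hZs.differentiableOn (by simp)
  have hZ0 : ∀ t ∈ Icc (0 : ℝ) 1, Z (0, t) = (chartAt (Model n) q q, 0) := by
    intro t ht
    rw [← covChart_zeroCov, hZ]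
    exact congrArg (covChart q) (hΓ0 _)
  -- Since the chart is the preferred one at the base point, the parameter derivative of the
  -- coordinates is the variation field itself.
  have hcurve : ∀ (e : ℝ × ℝ) (ξ : Fields n q),
      (∀ t, curveVelocity (cotI n) (fun s => Γ (s • e) t) 0 =
        (⟨constPath n q t, ξ t⟩ : TangentBundle (cotI n) (Cotangent n N))) →
      ∀ t ∈ Icc (0 : ℝ) 1, fderivWithin ℝ Z S (0, t) (e, 0) = fieldExt ξ t := by
    intro e ξ hξ t ht
    have h1 := hasDerivAt_partial hU ht e 0 (s := 0) (by simpa using h0)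
      (hZd _ ⟨by simpa using h0, ht⟩)
    simp only [zero_smul, add_zero, zero_add] at h1
    have hpre : (fun s : ℝ => s • e) ⁻¹' U ∈ 𝓝 (0 : ℝ) := by
      have hc : Continuous fun s : ℝ => s • e := by fun_prop
      exact hc.continuousAt.preimage_mem_nhds (hU.mem_nhds (by simpa using h0))
    have hcm : ContMDiffAt 𝓘(ℝ, ℝ) (cotI n) ∞ (fun s : ℝ => Γ (s • e) ⟨t, ht⟩) 0 := by
      have h2 : ContMDiffOn 𝓘(ℝ, ℝ) (cotI n) ∞
          (fun s : ℝ => IccExtend (zero_le_one (α := ℝ)) (Γ (s • e)) t)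
          ((fun s : ℝ => s • e) ⁻¹' U) :=
        hsm.comp (f := fun s : ℝ => (s • e, t)) (contMDiffOn_iff_contDiffOn.2 (by fun_prop))
          fun s hs => ⟨hs, ht⟩
      have h3 := h2.contMDiffAt hpre
      simpa only [IccExtend_of_mem _ _ ht] using h3
    have h4 := ((curveVelocity_eq_iff_self hcm _).1 (hξ ⟨t, ht⟩)).2
    have h5 : fieldExt ξ t = ξ ⟨t, ht⟩ := IccExtend_of_mem _ _ ht
    rw [h5]
    refine h1.unique ?_
    convert! h4 using 1
    funext s
    rw [hZ]
    simp only [IccExtend_of_mem _ _ ht]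
    rfl
  have hc₁ := hcurve (1, 0) ξ₁ fun t => by
    simpa using hv₁ t
  have hc₂ := hcurve (0, 1) ξ₂ fun t => by
    simpa using hv₂ t
  set Zt : (ℝ × ℝ) × ℝ → CotModel n := fun p => fderivWithin ℝ Z S p (0, 1) with hZt
  have hZts : ContDiffOn ℝ ∞ Zt S := contDiffOn_partial hU hZs (0, 1)
  have hZt0 : ∀ t ∈ Icc (0 : ℝ) 1, Zt (0, t) = 0 := by
    intro t ht
    have h1 := fderivWithin_time h0 (hZd (0, t) ⟨h0, ht⟩)
    have h2 : HasDerivWithinAt (fun r => Z (0, r)) 0 (Icc (0 : ℝ) 1) t :=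
      (hasDerivWithinAt_const t _ _).congr hZ0 (hZ0 t ht)
    exact (uniqueDiffOn_Icc zero_lt_one t ht).eq_deriv _ h1 h2
  -- By symmetry of second derivatives, the variation of the velocity is the time derivative of the
  -- variation field.
  have hZtp : ∀ (e : ℝ × ℝ) (ξ : Fields n q),
      (∀ t ∈ Icc (0 : ℝ) 1, fderivWithin ℝ Z S (0, t) (e, 0) = fieldExt ξ t) →
      ∀ t ∈ Icc (0 : ℝ) 1, fderivWithin ℝ Zt S (0, t) (e, 0) = dt (fieldExt ξ) t := by
    intro e ξ hξ t ht
    rw [hZt, partial_comm hU hZs ⟨h0, ht⟩]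
    have h1 := fderivWithin_time h0
      ((contDiffOn_partial hU hZs (e, 0)).differentiableOn (by simp) (0, t) ⟨h0, ht⟩)
    exact (dt_eq ht (h1.congr (fun r hr => (hξ r hr).symm) (hξ t ht).symm)).symm
  have hfst : ∀ {h : (ℝ × ℝ) × ℝ → CotModel n} {p}, p ∈ S → DifferentiableOn ℝ h S → ∀ v,
      fderivWithin ℝ (fun p => (h p).1) S p v = (fderivWithin ℝ h S p v).1 := by
    intro h p hp hh v
    rw [(hh p hp).hasFDerivWithinAt.fst.fderivWithin (hu p hp)]
    rfl
  have hsnd : ∀ {h : (ℝ × ℝ) × ℝ → CotModel n} {p}, p ∈ S → DifferentiableOn ℝ h S → ∀ v,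
      fderivWithin ℝ (fun p => (h p).2) S p v = (fderivWithin ℝ h S p v).2 := by
    intro h p hp hh v
    rw [(hh p hp).hasFDerivWithinAt.snd.fderivWithin (hu p hp)]
    rfl
  have hRs : ContDiffOn ℝ ∞ (fun p => localSharp g q (Z p).1) S := by
    refine (contDiffOn_localSharp g q).comp hZs.fst fun p hp => ?_
    have h1 := (covChart q).map_source (hsrc p.1 hp.1 ⟨p.2, hp.2⟩)
    rw [covChart_target] at h1
    have h2 : Z p = covChart q (Γ p.1 ⟨p.2, hp.2⟩) := by
      rw [hZ]
      simp only [IccExtend_of_mem _ _ hp.2]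
    rw [h2]
    exact h1.1
  -- The derivative of the dual metric is applied to the covector part of `Z (0, t)`, which is zero.
  have hRp : ∀ t ∈ Icc (0 : ℝ) 1, ∀ v,
      fderivWithin ℝ (fun p => localSharp g q (Z p).1 (Z p).2) S (0, t) v =
        sharpL g q (fderivWithin ℝ Z S (0, t) v).2 := by
    intro t ht v
    have hp : ((0 : ℝ × ℝ), t) ∈ S := ⟨h0, ht⟩
    rw [((hRs.differentiableOn (by simp) _ hp).hasFDerivWithinAt.clm_apply
      (hZd _ hp).hasFDerivWithinAt.snd).fderivWithin (hu _ hp)]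
    simp [hZ0 t ht, localSharp_self]
  have hhalf : ∀ t ∈ Icc (0 : ℝ) 1, ∀ v,
      fderivWithin ℝ (fun p => (1 / 2 : ℝ) • (Z p).2) S (0, t) v =
        (1 / 2 : ℝ) • (fderivWithin ℝ Z S (0, t) v).2 := by
    intro t ht v
    have hp : ((0 : ℝ × ℝ), t) ∈ S := ⟨h0, ht⟩
    exact congrArg (fun A => A v)
      (((hZd _ hp).hasFDerivWithinAt.snd.const_smul (1 / 2 : ℝ)).fderivWithin (hu _ hp))
  obtain ⟨A₁, hA₁, hA₁'⟩ := mixed_deriv_integral_pairing hU h0 hZs.snd hZts.fst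
    (fun t ht => by rw [hZ0 t ht]) (fun t ht => by rw [hZt0 t ht]; rfl)
  have hhs : ContDiffOn ℝ ∞ (fun p => (1 / 2 : ℝ) • (Z p).2) S := hZs.snd.const_smul (1 / 2 : ℝ)
  obtain ⟨A₂, hA₂, hA₂'⟩ := mixed_deriv_integral_pairing hU h0 hhs (hRs.clm_apply hZs.snd)
    (fun t ht => by rw [hZ0 t ht, smul_zero]) (fun t ht => by rw [hZ0 t ht, map_zero])
  refine ⟨fun s => -A₁ s + A₂ s, ?_, ?_⟩
  · have hs : ∀ᶠ s in 𝓝 (0 : ℝ), (s, (0 : ℝ)) ∈ U := by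
      have hc : Continuous fun s : ℝ => (s, (0 : ℝ)) := by fun_prop
      exact hc.continuousAt.eventually_mem (hU.mem_nhds h0U)
    filter_upwards [hA₁, hA₂, hs] with s h1 h2 h3
    refine (h1.neg.add h2).congr_of_eventuallyEq ?_
    have hc : Continuous fun u : ℝ => (s, u) := by fun_prop
    filter_upwards [hc.continuousAt.eventually_mem (hU.mem_nhds h3)] with u hu
    exact action_eq g hsm hsrc hZ hZs hu
  · refine (hA₁'.neg.add hA₂').congr_deriv ?_
    have hI : ∀ {f : ℝ → ℝ}, ContDiffOn ℝ ∞ f (Icc (0 : ℝ) 1) → IntegrableOn f (Icc (0 : ℝ) 1) :=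
      fun hf => hf.continuousOn.integrableOn_Icc
    have e₁ : ∀ t ∈ Icc (0 : ℝ) 1,
        fderivWithin ℝ (fun p => (Z p).2) S (0, t) ((1, 0), 0)
            (fderivWithin ℝ (fun p => (Zt p).1) S (0, t) ((0, 1), 0)) +
          fderivWithin ℝ (fun p => (Z p).2) S (0, t) ((0, 1), 0)
            (fderivWithin ℝ (fun p => (Zt p).1) S (0, t) ((1, 0), 0)) =
        (fieldExt ξ₁ t).2 (dt (fieldExt ξ₂) t).1 + (fieldExt ξ₂ t).2 (dt (fieldExt ξ₁) t).1 := by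
      intro t ht
      have hp : ((0 : ℝ × ℝ), t) ∈ S := ⟨h0, ht⟩
      have hZtd := hZts.differentiableOn (by simp)
      rw [hsnd hp hZd, hsnd hp hZd, hfst hp hZtd, hfst hp hZtd, hc₁ t ht, hc₂ t ht,
        hZtp _ _ hc₁ t ht, hZtp _ _ hc₂ t ht]
    -- The two cross terms agree by symmetry of the dual metric, so their halves add up to one.
    have e₂ : ∀ t ∈ Icc (0 : ℝ) 1,
        fderivWithin ℝ (fun p => (1 / 2 : ℝ) • (Z p).2) S (0, t) ((1, 0), 0)
            (fderivWithin ℝ (fun p => localSharp g q (Z p).1 (Z p).2) S (0, t) ((0, 1), 0)) +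
          fderivWithin ℝ (fun p => (1 / 2 : ℝ) • (Z p).2) S (0, t) ((0, 1), 0)
            (fderivWithin ℝ (fun p => localSharp g q (Z p).1 (Z p).2) S (0, t) ((1, 0), 0)) =
        (fieldExt ξ₁ t).2 (sharpL g q (fieldExt ξ₂ t).2) := by
      intro t ht
      rw [hRp t ht, hRp t ht, hhalf t ht, hhalf t ht, hc₁ t ht, hc₂ t ht,
        smul_apply, smul_apply,
        (isMetricPair g q).apply_comm (fieldExt ξ₂ t).2, ← add_smul]
      norm_num
    rw [setIntegral_congr_fun measurableSet_Icc e₁, setIntegral_congr_fun measurableSet_Icc e₂,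
      ← integral_neg, ← integral_add]
    · rfl
    · exact (hI ((hξ₁.snd.clm_apply (contDiffOn_dt hξ₂).fst).add
        (hξ₂.snd.clm_apply (contDiffOn_dt hξ₁).fst))).neg
    · exact hI (hξ₁.snd.clm_apply ((sharpL g q).contDiff.comp_contDiffOn hξ₂.snd))

theorem SliceChart.isHessian {T : Set N} {q : N} {V : Submodule ℝ (Model n)}
    (s : SliceChart T q V) :
    IsHessian (cotI n) (action g) (conormal T) (constPath n q) (secondVariation g q) :=
  fun _ h₁ _ h₂ => ⟨s.exists_isVariation h₁ h₂, fun _ hΓ =>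
    mixed_deriv_action g ((s.mem_pathTangent_iff _).1 h₁).1 ((s.mem_pathTangent_iff _).1 h₂).1 hΓ⟩

end Hessian

/-! ### The constant chords -/

section ConstantChords

variable {n : ℕ} {N : Type*} [TopologicalSpace N] [ChartedSpace (Model n) N]
  [IsManifold (𝓡 n) ∞ N] (g : RiemMetric n N)

/-- The preferred chart of the cotangent bundle at `x` depends only on the base point, so it is also
the chart centred at the zero covector over that point. -/
theorem mfderiv_kinetic (x : Cotangent n N) (ζ : CotModel n) :
    mfderiv (cotI n) 𝓘(ℝ, ℝ) (kinetic g) x ζ =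
      fderiv ℝ (kinetic g ∘ (covChart x.1).symm) (covChart x.1 x) ζ := by
  have h1 := ((contMDiff_kinetic g).mdifferentiable (by simp) x).mfderiv
  have h2 : range (cotI n) = univ := (cotI n).range_eq_univ
  rw [h2, fderivWithin_univ] at h1
  exact congrArg (fun A : CotModel n →L[ℝ] ℝ => A ζ) h1

theorem kinetic_nonneg (x : Cotangent n N) : 0 ≤ kinetic g x :=
  mul_nonneg (by norm_num) ((isMetricPair g x.1).nonneg _)

theorem kinetic_zeroCov (q : N) : kinetic g (zeroCov q) = 0 := by
  rw [kinetic_eq, show covec (zeroCov (n := n) q) = 0 from rfl]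
  simp

/-- The kinetic energy is nonnegative and vanishes here, so this is a minimum. -/
theorem mfderiv_kinetic_zeroCov (q : N) (ζ : CotModel n) :
    mfderiv (cotI n) 𝓘(ℝ, ℝ) (kinetic g) (zeroCov q) ζ = 0 := by
  rw [mfderiv_kinetic]
  have hmin : IsLocalMin (kinetic g ∘ (covChart q).symm) (covChart q (zeroCov q)) := by
    refine Eventually.of_forall fun z => ?_
    rw [Function.comp_apply, (covChart q).left_inv (mem_extChartAt_source _), kinetic_zeroCov]
    exact kinetic_nonneg g _
  exact congrArg (fun A : CotModel n →L[ℝ] ℝ => A ζ) hmin.fderiv_eq_zero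

/-- Euler's identity: along the fibre ray `r ↦ r p` the energy is `r²` times its value at `x`, so
its derivative at `r = 1` is both `0` and twice that value. Positivity of the metric then gives `p =
0`. -/
theorem eq_zeroCov_of_mfderiv_kinetic {x : Cotangent n N}
    (hx : ∀ ζ : CotModel n, mfderiv (cotI n) 𝓘(ℝ, ℝ) (kinetic g) x ζ = 0) : x = zeroCov x.1 := by
  have hxs : x ∈ (covChart x.1).source := by
    rw [covChart_source]
    exact mem_chart_source _ _
  set z := covChart x.1 x with hz
  have hzt : z ∈ (covChart x.1).target := (covChart x.1).map_source hxs
  have hmem : ∀ r : ℝ, (z.1, r • z.2) ∈ (covChart x.1).target := fun r => by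
    rw [covChart_target] at hzt ⊢
    exact ⟨hzt.1, mem_univ _⟩
  have hcm : ContMDiffAt 𝓘(ℝ, CotModel n) 𝓘(ℝ, ℝ) ∞ (kinetic g ∘ (covChart x.1).symm) z :=
    ((contMDiff_kinetic g).comp_contMDiffOn (contMDiffOn_extChartAt_symm _)).contMDiffAt
      ((isOpen_extChartAt_target _).mem_nhds hzt)
  have hd : HasFDerivAt (kinetic g ∘ (covChart x.1).symm) (0 : CotModel n →L[ℝ] ℝ) z := by
    have h0 : fderiv ℝ (kinetic g ∘ (covChart x.1).symm) z = 0 :=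
      ContinuousLinearMap.ext fun ζ => (mfderiv_kinetic g x ζ).symm.trans (hx ζ)
    rw [← h0]
    exact (hcm.contDiffAt.differentiableAt (by simp)).hasFDerivAt
  have hl : HasDerivAt (fun r : ℝ => (z.1, r • z.2)) (0, z.2) 1 := by
    have := (hasDerivAt_id (1 : ℝ)).smul_const z.2
    rw [one_smul] at this
    exact (hasDerivAt_const _ _).prodMk this
  have h1 : HasDerivAt (fun r : ℝ => r ^ 2 * kinetic g x) 0 1 := by
    have h2 := HasFDerivAt.comp_hasDerivAt (1 : ℝ) (l := kinetic g ∘ (covChart x.1).symm)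
      (l' := 0) (by rwa [one_smul]) hl
    refine h2.congr_of_eventuallyEq (Eventually.of_forall fun r => ?_)
    have h3 := (covChart x.1).map_target (hmem r)
    rw [covChart_source] at h3
    change _ = kinetic g ((covChart x.1).symm (z.1, r • z.2))
    rw [kinetic_eq_local g h3, (covChart x.1).right_inv (hmem r),
      kinetic_eq_local g (mem_chart_source _ x.1), ← hz]
    simp
    ring
  have h2 : HasDerivAt (fun r : ℝ => r ^ 2 * kinetic g x) (2 * kinetic g x) 1 := by
    simpa using (hasDerivAt_pow 2 (1 : ℝ)).mul_const (kinetic g x)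
  have h3 : kinetic g x = 0 := by linarith [h1.unique h2]
  rw [kinetic_eq] at h3
  have hp := isMetricPair g x.1
  have h4 : sharpL g x.1 (covec x) = 0 := hp.eq_zero (by rw [hp.right]; linarith)
  have h5 : covec x = 0 := by rw [← hp.right (covec x), h4, map_zero]
  obtain ⟨q, p⟩ := x
  exact congrArg (TotalSpace.mk q) h5

theorem velocity_const (x : Cotangent n N) (t : I) :
    velocity (cotI n) (fun _ : I => x) t = (0 : CotModel n) := by
  have h : mfderivWithin 𝓘(ℝ, ℝ) (cotI n) (fun _ : ℝ => x) (Icc 0 1) (t : ℝ) = 0 :=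
    mfderivWithin_const
  exact congrArg (fun A : ℝ →L[ℝ] CotModel n => A 1) h

theorem symp_zero_left (x : Cotangent n N) (ζ : CotModel n) :
    symp x (0 : CotModel n) ζ = 0 := by
  simp [symp]

theorem constChords_conormal (T : Set N) :
    constChords g (conormal T) = {γ | ∃ q ∈ T, ∀ t, γ t = zeroCov q} := by
  ext γ
  constructor
  · rintro ⟨⟨⟨-, h0, -⟩, hch⟩, x, hx⟩
    obtain rfl : γ = fun _ => x := funext hx
    refine ⟨x.1, h0.1, fun _ => eq_zeroCov_of_mfderiv_kinetic g fun ζ => ?_⟩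
    refine (hch 0 ζ).symm.trans ?_
    refine (congrArg (fun w : CotModel n => symp x w ζ) (velocity_const x 0)).trans ?_
    exact symp_zero_left x ζ
  · rintro ⟨q, hq, hγ⟩
    obtain rfl : γ = fun _ => zeroCov q := funext hγ
    have hc : zeroCov (n := n) q ∈ conormal T := ⟨hq, fun v _ => rfl⟩
    refine ⟨⟨⟨contMDiffOn_const, hc, hc⟩, fun t ζ => ?_⟩, zeroCov q, hγ⟩
    refine Eq.trans ?_ (mfderiv_kinetic_zeroCov g q ζ).symm
    refine (congrArg (fun w : CotModel n => symp (zeroCov q) w ζ)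
      (velocity_const (zeroCov q) t)).trans ?_
    exact symp_zero_left _ ζ

theorem contMDiff_zeroCov : ContMDiff (𝓡 n) (cotI n) ∞ (zeroCov (n := n) (N := N)) :=
  Bundle.contMDiff_zeroSection ℝ _

/-- A smooth `f` is composed with the zero section. Conversely `f` is recovered from the family by
restricting to time `0` and projecting to the base. -/
theorem isDiffeoOnto_constPath (T : Set N) :
    IsDiffeoOnto T (constChords g (conormal T)) (constPath n) := by
  rw [constChords_conormal]
  refine ⟨⟨fun q hq => ⟨q, hq, fun _ => rfl⟩, fun q _ q' _ h => ?_, ?_⟩, fun m U f _ _ => ?_⟩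
  · exact congrArg TotalSpace.proj (congrFun h 0)
  · rintro γ ⟨q, hq, hγ⟩
    exact ⟨q, hq, (funext hγ).symm⟩
  · constructor
    · intro hf
      have h1 : ContMDiffOn 𝓘(ℝ, Model m × ℝ) (𝓡 n) ∞ (fun z : Model m × ℝ => f z.1)
          (U ×ˢ Icc (0 : ℝ) 1) :=
        hf.comp contDiff_fst.contMDiff.contMDiffOn fun z hz => hz.1
      exact contMDiff_zeroCov.comp_contMDiffOn h1
    · intro hf
      have h1 : ContMDiffOn 𝓘(ℝ, Model m) (cotI n) ∞ (fun s => zeroCov (n := n) (f s)) U :=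
        hf.comp (f := fun s => (s, (0 : ℝ))) (contMDiffOn_iff_contDiffOn.2 (by fun_prop))
          fun s hs => ⟨hs, left_mem_Icc.2 zero_le_one⟩
      exact (contMDiff_proj _).comp_contMDiffOn h1

variable {g}

/-- A curve of constant chords is the zero section applied to a curve in `T`, so its variation field
is constant in time, with horizontal part tangent to `T` and no vertical part. -/
theorem SliceChart.mem_familyTangent_iff {T : Set N} {q : N} {V : Submodule ℝ (Model n)}
    (s : SliceChart T q V) (hq : q ∈ T) (ξ : Fields n q) :
    ξ ∈ familyTangent (cotI n) (constChords g (conormal T)) (constPath n q) ↔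
      ∃ v ∈ V, ∀ t, (ξ t : CotModel n) = (v, 0) := by
  rw [constChords_conormal]
  have hcoord : ∀ (c : ℝ → N) (v : Model n), ContMDiffAt 𝓘(ℝ, ℝ) (𝓡 n) ∞ c 0 →
      curveVelocity (𝓡 n) c 0 = (⟨q, v⟩ : TangentBundle (𝓡 n) N) →
      curveVelocity (cotI n) (fun r => zeroCov (n := n) (c r)) 0 =
        (⟨zeroCov q, ((v, 0) : CotModel n)⟩ : TangentBundle (cotI n) (Cotangent n N)) := by
    intro c v hc hv
    obtain ⟨h1, h2⟩ := (curveVelocity_eq_iff_self hc v).1 hv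
    refine (curveVelocity_eq_iff_self (contMDiff_zeroCov.contMDiffAt.comp (0 : ℝ) hc) _).2
      ⟨congrArg zeroCov h1, ?_⟩
    have h3 : HasDerivAt (fun r => (chartAt (Model n) q (c r), (0 : Model n →L[ℝ] ℝ))) (v, 0) 0 :=
      HasDerivAt.prodMk h2 (hasDerivAt_const _ _)
    refine h3.congr_of_eventuallyEq (Eventually.of_forall fun r => ?_)
    exact covChart_zeroCov q (c r)
  constructor
  · rintro ⟨Γ, U, hU, h0, hΓ, hmem, hv⟩
    have hsm : ContMDiffOn 𝓘(ℝ, ℝ) (cotI n) ∞ (fun r => Γ r 0) U := by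
      refine (hΓ.comp (f := fun r : ℝ => (r, (0 : ℝ))) (contMDiffOn_iff_contDiffOn.2 (by fun_prop))
        fun r hr => ⟨hr, left_mem_Icc.2 zero_le_one⟩).congr fun r _ => ?_
      exact (IccExtend_left _ _).symm
    have : Nonempty N := ⟨q⟩
    -- The chosen base points form a smooth curve because on `U` they are the projection of the path
    -- family at time `0`.
    choose! c hcT hc using hmem
    have hcs : ContMDiffOn 𝓘(ℝ, ℝ) (𝓡 n) ∞ c U := by
      refine ((contMDiff_proj _).comp_contMDiffOn hsm).congr fun r hr => ?_
      exact (congrArg TotalSpace.proj (hc r hr 0)).symm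
    have hcat := hcs.contMDiffAt (hU.mem_nhds h0)
    have hc0 : c 0 = q := by
      have h1 : Γ 0 0 = zeroCov q := congrArg TotalSpace.proj (hv 0)
      exact congrArg TotalSpace.proj ((hc 0 h0 0).symm.trans h1)
    obtain ⟨v, hcv⟩ : ∃ v : Model n, curveVelocity (𝓡 n) c 0 = (⟨q, v⟩ : TangentBundle (𝓡 n) N) := by
      rw [← hc0]
      exact ⟨_, rfl⟩
    refine ⟨v, (s.isTangentTo_base_iff hq v).1 ⟨c, U, hU, h0, hcs, hcT, hcv⟩, fun t => ?_⟩
    have h1 := hcoord c v hcat hcv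
    have h2 : ContMDiffAt 𝓘(ℝ, ℝ) (cotI n) ∞ (fun r => zeroCov (n := n) (c r)) 0 :=
      contMDiff_zeroCov.contMDiffAt.comp (0 : ℝ) hcat
    have heq : (fun r => Γ r t) =ᶠ[𝓝 0] fun r => zeroCov (n := n) (c r) := by
      filter_upwards [hU.mem_nhds h0] with r hr
      exact hc r hr t
    have h3 := ((curveVelocity_eq_iff_self (h2.congr_of_eventuallyEq heq) _).1 (hv t)).2
    have h4 := ((curveVelocity_eq_iff_self h2 _).1 h1).2
    have h5 := h3.congr_of_eventuallyEq (heq.symm.fun_comp _)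
    exact h5.unique h4
  · rintro ⟨v, hvV, hξ⟩
    obtain ⟨c, U, hU, h0, hc, hcT, hv⟩ := (s.isTangentTo_base_iff hq v).2 hvV
    refine ⟨fun r => constPath n (c r), U, hU, h0, ?_, fun r hr => ⟨c r, hcT r hr, fun _ => rfl⟩,
      fun t => ?_⟩
    · have h1 : ContMDiffOn 𝓘(ℝ, ℝ × ℝ) (𝓡 n) ∞ (fun z : ℝ × ℝ => c z.1)
          (U ×ˢ Icc (0 : ℝ) 1) :=
        hc.comp contDiff_fst.contMDiff.contMDiffOn fun z hz => hz.1
      exact contMDiff_zeroCov.comp_contMDiffOn h1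
    · refine (hcoord c v (hc.contMDiffAt (hU.mem_nhds h0)) hv).trans ?_
      exact congrArg (fun w : CotModel n =>
        (⟨zeroCov q, w⟩ : TangentBundle (cotI n) (Cotangent n N))) (hξ t).symm

end ConstantChords

/-! ### Kernel and cokernel of the second variation -/

section LinearModel

variable {E : Type*} [NormedAddCommGroup E] [NormedSpace ℝ E]
  {G : E →L[ℝ] E →L[ℝ] ℝ} {S : (E →L[ℝ] ℝ) →L[ℝ] E} {V : Submodule ℝ E}

theorem dt_congr {W : Type*} [NormedAddCommGroup W] [NormedSpace ℝ W] {f₁ f₂ : ℝ → W}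
    (h : EqOn f₁ f₂ (Icc (0 : ℝ) 1)) {t : ℝ} (ht : t ∈ Icc (0 : ℝ) 1) : dt f₁ t = dt f₂ t :=
  derivWithin_congr h (h ht)

theorem linHess_congr_right {ζ ζ₁ ζ₂ : ℝ → E × (E →L[ℝ] ℝ)} (h : EqOn ζ₁ ζ₂ (Icc (0 : ℝ) 1)) :
    linHess S ζ ζ₁ = linHess S ζ ζ₂ :=
  setIntegral_congr_fun measurableSet_Icc fun t ht => by
    simp only [dt_congr h ht, h ht]

theorem hessOp_congr {ζ₁ ζ₂ : ℝ → E × (E →L[ℝ] ℝ)} (h : EqOn ζ₁ ζ₂ (Icc (0 : ℝ) 1)) {t : ℝ}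
    (ht : t ∈ Icc (0 : ℝ) 1) : hessOp G S ζ₁ t = hessOp G S ζ₂ t := by
  simp only [hessOp, dt_congr h ht, h ht]

theorem IsAdm.congr {ζ₁ ζ₂ : ℝ → E × (E →L[ℝ] ℝ)} (h₁ : IsAdm V ζ₁)
    (h : EqOn ζ₂ ζ₁ (Icc (0 : ℝ) 1)) : IsAdm V ζ₂ := by
  refine ⟨h₁.1.congr h, ?_, ?_⟩
  · rw [h (left_mem_Icc.2 zero_le_one)]
    exact h₁.2.1
  · rw [h (right_mem_Icc.2 zero_le_one)]
    exact h₁.2.2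

theorem hessOp_const {ζ : ℝ → E × (E →L[ℝ] ℝ)} {v : E}
    (h : ∀ t ∈ Icc (0 : ℝ) 1, ζ t = (v, 0)) {t : ℝ} (ht : t ∈ Icc (0 : ℝ) 1) :
    hessOp G S ζ t = 0 := by
  have hd : dt ζ t = 0 :=
    (dt_congr (f₂ := fun _ => (v, 0)) h ht).trans (dt_eq ht (hasDerivWithinAt_const _ _ _))
  simp [hessOp, hd, h t ht]

/-- The almost complex structure on the linear model which relates the canonical symplectic form
to the Sasaki metric. -/
def sasakiJ (G : E →L[ℝ] E →L[ℝ] ℝ) (S : (E →L[ℝ] ℝ) →L[ℝ] E) :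
    E × (E →L[ℝ] ℝ) →L[ℝ] E × (E →L[ℝ] ℝ) :=
  (S ∘L ContinuousLinearMap.snd ℝ E (E →L[ℝ] ℝ)).prod
    (-(G ∘L ContinuousLinearMap.fst ℝ E (E →L[ℝ] ℝ)))

theorem sasakiJ_apply (x : E × (E →L[ℝ] ℝ)) : sasakiJ G S x = (S x.2, -G x.1) := rfl

theorem IsMetricPair.linSasaki_sasakiJ (h : IsMetricPair G S) (x y : E × (E →L[ℝ] ℝ)) :
    linSasaki G S (sasakiJ G S x) y = linSasaki G S x (-sasakiJ G S y) := by
  simp only [linSasaki, sasakiJ_apply, Prod.fst_neg, Prod.snd_neg, map_neg, neg_neg, h.left,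
    neg_apply]
  ring

theorem IsMetricPair.eq_zero_of_sasakiJ (h : IsMetricPair G S) {x : E × (E →L[ℝ] ℝ)}
    (hx : sasakiJ G S x = 0) : x = 0 := by
  rw [sasakiJ_apply, Prod.mk_eq_zero, neg_eq_zero] at hx
  refine Prod.ext ?_ ?_
  · rw [← h.left x.1, hx.2, map_zero]
    rfl
  · rw [← h.right x.2, hx.1, map_zero]
    rfl

end LinearModel

/-! ### Transfer from the linear model to vector fields along the constant chord -/

section Nondegenerate

variable {n : ℕ} {N : Type*} [TopologicalSpace N] [ChartedSpace (Model n) N]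
  [IsManifold (𝓡 n) ∞ N] (g : RiemMetric n N)

/-- The restriction to the unit interval of a vector field on the line. -/
def fieldOf (q : N) (ζ : ℝ → CotModel n) : Fields n q := fun t : I => ζ t

theorem fieldExt_fieldOf (q : N) (ζ : ℝ → CotModel n) :
    EqOn (fieldExt (fieldOf q ζ)) ζ (Icc (0 : ℝ) 1) :=
  fun _ ht => IccExtend_of_mem _ _ ht

theorem SliceChart.hessianKernel_eq {T : Set N} {q : N} {V : Submodule ℝ (Model n)}
    (s : SliceChart T q V) (hq : q ∈ T) :
    hessianKernel (cotI n) (conormal T) (constPath n q) (secondVariation g q) =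
      familyTangent (cotI n) (constChords g (conormal T)) (constPath n q) := by
  have hp := isMetricPair g q
  ext ξ
  rw [s.mem_familyTangent_iff hq]
  constructor
  · rintro ⟨h1, h2⟩
    rw [s.mem_pathTangent_iff] at h1
    obtain ⟨v, hv, hξ⟩ := h1.eq_const hp fun ζ hζ => by
      rw [← linHess_congr_right (fieldExt_fieldOf q ζ)]
      exact h2 _ ((s.mem_pathTangent_iff _).2 (hζ.congr (fieldExt_fieldOf q ζ)))
    exact ⟨v, hv, fun t => (fieldExt_coe ξ t).symm.trans (hξ t t.2)⟩
  · rintro ⟨v, hv, hξ⟩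
    have hξ' : ∀ t ∈ Icc (0 : ℝ) 1, fieldExt ξ t = (v, 0) := fun t ht =>
      (fieldExt_coe ξ ⟨t, ht⟩).trans (hξ _)
    have hc : IsAdm V fun _ : ℝ => (v, (0 : Model n →L[ℝ] ℝ)) :=
      ⟨contDiffOn_const, ⟨hv, fun _ _ => rfl⟩, ⟨hv, fun _ _ => rfl⟩⟩
    have hadm : IsAdm V (fieldExt ξ) := hc.congr hξ'
    refine ⟨(s.mem_pathTangent_iff _).2 hadm, fun ξ₂ h₂ => ?_⟩
    rw [s.mem_pathTangent_iff] at h₂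
    rw [secondVariation, hadm.linHess_eq hp h₂]
    refine (setIntegral_congr_fun measurableSet_Icc fun t ht => ?_).trans (integral_zero _ _)
    simp [hessOp_const hξ' ht, linSasaki]

open Classical in
/-- The operator representing the second variation, composed with a linear map `C`. -/
def hessLp (q : N) (C : CotModel n →L[ℝ] CotModel n) (ξ : Fields n q) : L2Fields n :=
  if h : MemLp (fun t : I => C (hessOp (metricAt g q) (sharpL g q) (fieldExt ξ) t)) 2 volume
  then h.toLp else 0

/-- For a smooth field the image is continuous on the compact interval, hence square integrable, so
the default value `0` in `hessLp` does not occur. -/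
theorem hessLp_ae_eq {q : N} (C : CotModel n →L[ℝ] CotModel n) {ξ : Fields n q}
    (hξ : ContDiffOn ℝ ∞ (fieldExt ξ) (Icc (0 : ℝ) 1)) :
    ∀ᵐ t : I, hessLp g q C ξ t = C (hessOp (metricAt g q) (sharpL g q) (fieldExt ξ) t) := by
  have hc : Continuous fun t : I => C (hessOp (metricAt g q) (sharpL g q) (fieldExt ξ) t) :=
    C.continuous.comp (contDiffOn_hessOp hξ).continuousOn.domRestrict
  have h : MemLp (fun t : I => C (hessOp (metricAt g q) (sharpL g q) (fieldExt ξ) t)) 2 volume :=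
    hc.memLp_of_hasCompactSupport (HasCompactSupport.of_compactSpace _)
  rw [hessLp, dif_pos h]
  exact h.coeFn_toLp

/-- If `C` intertwines the pairing `P` with the Sasaki metric, then `C ∘ hessOp` represents the
second variation through `P`, and its cokernel meets the `P`-annihilator of the tangent space of
the critical family trivially. -/
theorem SliceChart.exists_operator {T : Set N} {q : N} {V : Submodule ℝ (Model n)}
    (s : SliceChart T q V) (hq : q ∈ T)
    (P : TangentSpace (cotI n) (zeroCov (n := n) q) →
      TangentSpace (cotI n) (zeroCov (n := n) q) → ℝ)
    (C C' : CotModel n →L[ℝ] CotModel n) (c : ℝ)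
    (hP : ∀ x y : CotModel n, P (C x) y = linSasaki (metricAt g q) (sharpL g q) x y)
    (hC : ∀ x y : CotModel n, linSasaki (metricAt g q) (sharpL g q) (C x) y =
      linSasaki (metricAt g q) (sharpL g q) x (C' y))
    (hann : ∀ (v : Model n) (y : CotModel n),
      metricAt g q v (C' y).1 = c * P ((v, 0) : CotModel n) y)
    (hP0 : ∀ x : CotModel n, P x (0 : CotModel n) = 0) (hinj : ∀ y, C' y = 0 → y = 0) :
    ∃ D : Fields n q → L2Fields n,
      Represents (conormal T) q P (secondVariation g q) D ∧
      cokernel g (conormal T) q D ∩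
        annihilator q P (familyTangent (cotI n) (constChords g (conormal T)) (constPath n q)) =
          {0} := by
  have hp := isMetricPair g q
  have hc0 : ∀ x : CotModel n, linSasaki (metricAt g q) (sharpL g q) x 0 = 0 := fun x => by
    simp [linSasaki]
  refine ⟨hessLp g q C, fun ξ₁ h₁ ξ₂ h₂ => ?_, Subset.antisymm ?_ ?_⟩
  · rw [s.mem_pathTangent_iff] at h₁ h₂
    rw [secondVariation, h₁.linHess_eq hp h₂, ← integral_unitInterval]
    refine integral_congr_ae ?_
    filter_upwards [hessLp_ae_eq g C h₁.1] with t ht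
    rw [fieldExt_coe, ht]
    exact (hP _ _).symm
  · rintro η ⟨hcok, han⟩
    -- Moving `C` to the other side as its adjoint `C'`, the cokernel and annihilator conditions on
    -- `η` become the Sasaki conditions on `C' η` treated in the linear model. Injectivity of `C'`
    -- then returns to `η`.
    set η' : ℝ → CotModel n := IccExtend (zero_le_one (α := ℝ)) (fun t : I => C' (η t)) with hη'
    have hcoe : ∀ t : I, η' t = C' (η t) := fun t => IccExtend_val _ _ t
    have hemb : MeasurableEmbedding ((↑) : I → ℝ) := MeasurableEmbedding.subtype_coe measurableSet_Icc
    have hmap : Measure.map ((↑) : I → ℝ) volume = volume.restrict (Icc (0 : ℝ) 1) :=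
      map_comap_subtype_coe measurableSet_Icc volume
    have hint : IntegrableOn η' (Icc (0 : ℝ) 1) := by
      rw [IntegrableOn, ← hmap, hemb.integrable_map_iff]
      have h1 : Integrable (fun t : I => C' (η t)) volume :=
        C'.integrable_comp ((Lp.memLp η).integrable (by norm_num))
      exact h1.congr (ae_of_all _ fun t => (hcoe t).symm)
    have h0 := ae_eq_zero_of_cokernel (V := V) hp hint (fun ζ hζ => ?_) (fun v hv => ?_)
    · rw [← hmap, hemb.ae_map_iff] at h0
      refine Lp.ext ?_
      filter_upwards [h0, Lp.coeFn_zero (CotModel n) 2 (volume : Measure I)] with t ht ht0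
      rw [ht0]
      exact hinj _ ((hcoe t).symm.trans ht)
    · have hadm : IsAdm V (fieldExt (fieldOf q ζ)) := hζ.congr (fieldExt_fieldOf q ζ)
      rw [← integral_unitInterval, ← hcok _ ((s.mem_pathTangent_iff _).2 hadm)]
      refine integral_congr_ae ?_
      filter_upwards [hessLp_ae_eq g C hadm.1] with t ht
      rw [ht, hcoe, ← hessOp_congr (fieldExt_fieldOf q ζ) t.2]
      exact (hC _ _).symm
    · have h1 := han (fun _ => ((v, 0) : CotModel n))
        ((s.mem_familyTangent_iff hq _).2 ⟨v, hv, fun _ => rfl⟩)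
      rw [← integral_unitInterval fun t => metricAt g q v (η' t).1]
      refine Eq.trans ?_ ((congrArg (c * ·) h1).trans (mul_zero c))
      rw [← integral_const_mul]
      refine integral_congr_ae (ae_of_all _ fun t => ?_)
      simp only [hcoe]
      exact hann v _
  · rintro η rfl
    have hz := Lp.coeFn_zero (CotModel n) 2 (volume : Measure I)
    refine ⟨fun ξ _ => ?_, fun ξ _ => ?_⟩
    · refine (integral_congr_ae ?_).trans (integral_zero _ _)
      filter_upwards [hz] with t ht
      rw [ht]
      exact hc0 _
    · refine (integral_congr_ae ?_).trans (integral_zero _ _)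
      filter_upwards [hz] with t ht
      rw [ht]
      exact hP0 _

theorem SliceChart.isBottNondegenerateAt {T : Set N} {q : N} {V : Submodule ℝ (Model n)}
    (s : SliceChart T q V) (hq : q ∈ T) :
    IsBottNondegenerateAt g (conormal T) (constChords g (conormal T)) q := by
  have hp := isMetricPair g q
  refine ⟨secondVariation g q, s.isHessian g, s.hessianKernel_eq g hq, ?_, ?_⟩
  · refine s.exists_operator g hq _ (sasakiJ (metricAt g q) (sharpL g q))
      (-sasakiJ (metricAt g q) (sharpL g q)) (-1) (fun x y => ?_) hp.linSasaki_sasakiJ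
      (fun v y => ?_) (fun x => by simp [symp]) fun y hy => ?_
    · change y.2 (sharpL g q x.2) - -(metricAt g q x.1 y.1) = _
      rw [linSasaki, hp.right, hp.apply_comm]
      ring
    · change metricAt g q v (-sharpL g q y.2) = -1 * (y.2 v - 0)
      rw [map_neg, hp.symm, hp.right]
      ring
    · exact hp.eq_zero_of_sasakiJ (neg_eq_zero.1 hy)
  · refine s.exists_operator g hq _ (ContinuousLinearMap.id ℝ _) (ContinuousLinearMap.id ℝ _) 1
      (fun x y => rfl) (fun x y => rfl) (fun v y => ?_) (fun x => ?_) fun y hy => hy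
    · change metricAt g q v y.1 = 1 * linSasaki (metricAt g q) (sharpL g q) (v, 0) y
      simp [linSasaki]
    · change linSasaki (metricAt g q) (sharpL g q) x 0 = 0
      simp [linSasaki]

end Nondegenerate

end ConormalChords

end


theorem mainTheorem10 (n k : ℕ) (hk : k ≤ n)
    (N : Type*) [TopologicalSpace N] [T2Space N] [SecondCountableTopology N]
    [ChartedSpace (Model n) N] [IsManifold (𝓡 n) ∞ N]
    (g : RiemMetric n N)
    (T : Set N) (hT : IsSubmanifold n k T) (hTc : IsCompact T) :
    constChords g (conormal T) = {γ | ∃ q ∈ T, ∀ t, γ t = zeroCov q} ∧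
    IsDiffeoOnto T (constChords g (conormal T)) (constPath n) ∧
    ∀ q ∈ T, IsBottNondegenerateAt g (conormal T) (constChords g (conormal T)) q := by
  refine ⟨constChords_conormal g T, isDiffeoOnto_constPath g T, fun q hq => ?_⟩
  obtain ⟨V, ⟨s⟩⟩ := hT.exists_sliceChart hq
  exact s.isBottNondegenerateAt g hq
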